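/- Let $k$ be a field of characteristic $2$ and let $G=\mathrm{SL}_2$ as an affine group scheme over $k$, with coordinate ring $k[G]=k[a,b,c,d]/(ad-bc-1)$, where $\begin{pmatrix}a&b\\c&d\end{pmatrix}$ is the general element of $G$. Let $T\subset G$ be the diagonal torus and let $N$ be the normalizer of $T$ in $G$. For a subgroup scheme $H\subset G$ let $k[G/H]\subset k[G]$ be the ring of functions $f$ with $f(xh)=f(x)$ for all $h\in H$; for $H=T$ and $H=N$ it is a $G$-module by left translation, $(g\cdot f)(x)=f(g^{-1}x)$, and $k[G/N]\subset k[G/T]$. For $r\ge 1$ let $G_r$ be the $r$-th Frobenius kernel of $G$, and for a $G$-module $M$ let $H^1(G,M)$ and $H^1(G_r,M)$ denote rational cohomology (first cohomology of the Hochschild complex), with the restriction maps $H^1(G,M)\to H^1(G_s,M)\to H^1(G_r,M)$ for $r\le s$. Then: 1. The functions $ab$ and $cd$ are algebraically independent over $k$ and $k[G/N]=k[ab,cd]$. (So $G/N\cong\mathbb A^2$, with coordinates $ab$ and $cd$.) 2. The function $ad$ lies in $k[G/T]$, and its class in $k[G/T]/k[G/N]$ is $G$-invariant. Let $\mathcal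 X$ be the extension of $G$-modules $$0\to k[G/N]\to E\to k\to 0$$ obtained by pulling back $0\to k[G/N]\to k[G/T]\to k[G/T]/k[G/N]\to 0$ along the homomorphism $k\to k[G/T]/k[G/N]$ that sends $1$ to the class of $ad$. Then $\mathcal X$ does not split as an extension of $G$-modules, but for every $r\ge 1$ it splits as an extension of $G_r$-modules. Correspondingly, the class $\xi\in H^1(G,k[G/N])$ of $\mathcal X$ is nonzero, and its restriction to $H^1(G_r,k[G/N])$ is zero for every $r\ge1$. 3. Hence $H^1(G,k[G/N])$ is not the inverse limit of the $H^1(G_r,k[G/N])$: the canonical map $$H^1(G,k[G/N])\longrightarrow \varprojlim_{r\ge 1} H^1(G_r,k[G/N])$$ is not bijective. -/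

import Mathlib

open scoped TensorProduct MatrixGroups

universe u

namespace RatCoh

noncomputable section Comodules

/-!
Representations of an affine group scheme `H` over a field `k` with coordinate bialgebra
`C = k[H]`, as right `C`-comodules: if `ρ m = ∑ mᵢ ⊗ fᵢ` then `h • m = ∑ fᵢ(h) mᵢ`.
-/

/-- A (right) `C`-comodule structure on `M`, i.e. an `H`-module structure on `M`, `C = k[H]`. -/
structure Coaction (k : Type u) (C : Type u) (M : Type u) [Field k] [CommRing C] [Bialgebra k C]
    [AddCommGroup M] [Module k M] where
  ρ : M →ₗ[k] M ⊗[k] C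
  coassoc : (TensorProduct.assoc k M C C).toLinearMap ∘ₗ ρ.rTensor C ∘ₗ ρ =
    (Coalgebra.comul (R := k) (A := C)).lTensor M ∘ₗ ρ
  counit_comp : (TensorProduct.rid k M).toLinearMap ∘ₗ
    (Coalgebra.counit (R := k) (A := C)).lTensor M ∘ₗ ρ = LinearMap.id

variable {k C D M N : Type u} [Field k] [CommRing C] [Bialgebra k C] [CommRing D] [Bialgebra k D]
  [AddCommGroup M] [Module k M] [AddCommGroup N] [Module k N]

namespace Coaction

/-- Homomorphisms of `H`-modules. -/
def IsEquivariant (ρ : Coaction k C M) (σ : Coaction k C N) (f : M →ₗ[k] N) : Prop :=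
  f.rTensor C ∘ₗ ρ.ρ = σ.ρ ∘ₗ f

/-- `m ↦ m ⊗ 1`. -/
def tmulOne (k C M : Type u) [Field k] [CommRing C] [Bialgebra k C]
    [AddCommGroup M] [Module k M] : M →ₗ[k] M ⊗[k] C :=
  (TensorProduct.mk k M C).flip 1

@[simp] theorem tmulOne_apply (m : M) : tmulOne k C M m = m ⊗ₜ 1 := rfl

/-- The fixed points `M^H`. -/
def invariants (ρ : Coaction k C M) : Submodule k M :=
  LinearMap.eqLocus ρ.ρ (tmulOne k C M)

/-- The trivial `H`-module structure on `M`. -/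
def trivial (k C M : Type u) [Field k] [CommRing C] [Bialgebra k C]
    [AddCommGroup M] [Module k M] : Coaction k C M where
  ρ := tmulOne k C M
  coassoc := by
    ext m
    simp [Algebra.TensorProduct.one_def]
  counit_comp := by
    ext m
    simp

/-- Restriction of an `H`-module along a homomorphism of group schemes `H' → H` with
comorphism `f : k[H] → k[H']`. -/
def res (ρ : Coaction k C M) (f : C →ₐc[k] D) : Coaction k D M where
  ρ := (f : C →ₗ[k] D).lTensor M ∘ₗ ρ.ρ
  coassoc := by
    have h1 : (TensorProduct.assoc k M D D).toLinearMap ∘ₗ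
        ((f : C →ₗ[k] D).lTensor M ∘ₗ ρ.ρ).rTensor D ∘ₗ (f : C →ₗ[k] D).lTensor M =
        (TensorProduct.map (f : C →ₗ[k] D) (f : C →ₗ[k] D)).lTensor M ∘ₗ
          (TensorProduct.assoc k M C C).toLinearMap ∘ₗ ρ.ρ.rTensor C := by
      ext m c
      simp only [TensorProduct.AlgebraTensorModule.curry_apply, TensorProduct.curry_apply,
        LinearMap.restrictScalars_self, LinearMap.comp_apply, LinearMap.lTensor_tmul,
        LinearMap.rTensor_tmul, LinearEquiv.coe_coe]
      induction ρ.ρ m using TensorProduct.induction_on with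
      | zero => simp
      | tmul x y => simp
      | add x y hx hy => simp only [TensorProduct.add_tmul, map_add, hx, hy]
    have h2 : TensorProduct.map (f : C →ₗ[k] D) (f : C →ₗ[k] D) ∘ₗ Coalgebra.comul =
        Coalgebra.comul ∘ₗ (f : C →ₗ[k] D) := CoalgHomClass.map_comp_comul f
    rw [← LinearMap.comp_assoc, ← LinearMap.comp_assoc, LinearMap.comp_assoc _ _
      (TensorProduct.assoc k M D D).toLinearMap, h1, LinearMap.comp_assoc, LinearMap.comp_assoc,
      ρ.coassoc, ← LinearMap.comp_assoc, ← LinearMap.lTensor_comp, h2, LinearMap.lTensor_comp,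
      LinearMap.comp_assoc]
  counit_comp := by
    have h2 : Coalgebra.counit ∘ₗ (f : C →ₗ[k] D) = Coalgebra.counit :=
      CoalgHomClass.counit_comp f
    rw [← LinearMap.comp_assoc _ _ (Coalgebra.counit.lTensor M), ← LinearMap.lTensor_comp, h2,
      ρ.counit_comp]

/-- A submodule `W` of `M` is `H`-stable if `ρ W ⊆ W ⊗ C`. -/
def IsStable (ρ : Coaction k C M) (W : Submodule k M) : Prop :=
  ∀ w ∈ W, ρ.ρ w ∈ LinearMap.range (W.subtype.rTensor C)

theorem rTensor_injective (f : M →ₗ[k] N) (hf : Function.Injective f) (P : Type u)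
    [AddCommGroup P] [Module k P] : Function.Injective (f.rTensor P) :=
  Module.Flat.rTensor_preserves_injective_linearMap f hf

/-- If `i : N → M` is injective and `σ` is compatible with the coaction `ρ` of `M`, then `σ` is a
coaction. -/
def ofInjective (ρ : Coaction k C M) (i : N →ₗ[k] M) (hi : Function.Injective i)
    (σ : N →ₗ[k] N ⊗[k] C) (h : i.rTensor C ∘ₗ σ = ρ.ρ ∘ₗ i) : Coaction k C N where
  ρ := σ
  coassoc := by
    have hinj := rTensor_injective i hi (C ⊗[k] C)
    apply LinearMap.ext
    intro n
    apply hinj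
    have e1 : i.rTensor (C ⊗[k] C) ∘ₗ (TensorProduct.assoc k N C C).toLinearMap =
        (TensorProduct.assoc k M C C).toLinearMap ∘ₗ (i.rTensor C).rTensor C := by
      ext; simp
    have e2 : i.rTensor (C ⊗[k] C) ∘ₗ Coalgebra.comul.lTensor N =
        Coalgebra.comul.lTensor M ∘ₗ i.rTensor C := by
      ext; simp
    have e3 : (i.rTensor C).rTensor C ∘ₗ σ.rTensor C = ρ.ρ.rTensor C ∘ₗ i.rTensor C := by
      rw [← LinearMap.rTensor_comp, h, LinearMap.rTensor_comp]
    have := LinearMap.congr_fun ρ.coassoc (i n)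
    have e1' := LinearMap.congr_fun e1 (σ.rTensor C (σ n))
    have e2' := LinearMap.congr_fun e2 (σ n)
    have e3' := LinearMap.congr_fun e3 (σ n)
    have h' := LinearMap.congr_fun h n
    simp only [LinearMap.comp_apply] at this e1' e2' e3' h' ⊢
    rw [e1', e2', e3', h', this]
  counit_comp := by
    apply LinearMap.ext
    intro n
    apply hi
    have e1 : i ∘ₗ (TensorProduct.rid k N).toLinearMap ∘ₗ
        (Coalgebra.counit (R := k) (A := C)).lTensor N =
        (TensorProduct.rid k M).toLinearMap ∘ₗ
          (Coalgebra.counit (R := k) (A := C)).lTensor M ∘ₗ i.rTensor C := by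
      ext; simp
    have := LinearMap.congr_fun ρ.counit_comp (i n)
    have e1' := LinearMap.congr_fun e1 (σ n)
    have h' := LinearMap.congr_fun h n
    simp only [LinearMap.comp_apply, LinearMap.id_apply] at this e1' h' ⊢
    rw [e1', h', this]

theorem coassoc_of_compat (ρ : Coaction k C M) (i : M →ₗ[k] N) (σ : N →ₗ[k] N ⊗[k] C)
    (h : i.rTensor C ∘ₗ ρ.ρ = σ ∘ₗ i) :
    ((TensorProduct.assoc k N C C).toLinearMap ∘ₗ σ.rTensor C ∘ₗ σ) ∘ₗ i =
      ((Coalgebra.comul (R := k) (A := C)).lTensor N ∘ₗ σ) ∘ₗ i := by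
  apply LinearMap.ext
  intro m
  have e1 : i.rTensor (C ⊗[k] C) ∘ₗ (TensorProduct.assoc k M C C).toLinearMap =
      (TensorProduct.assoc k N C C).toLinearMap ∘ₗ (i.rTensor C).rTensor C := by
    ext; simp
  have e2 : i.rTensor (C ⊗[k] C) ∘ₗ Coalgebra.comul.lTensor M =
      Coalgebra.comul.lTensor N ∘ₗ i.rTensor C := by
    ext; simp
  have e3 : (i.rTensor C).rTensor C ∘ₗ ρ.ρ.rTensor C = σ.rTensor C ∘ₗ i.rTensor C := by
    rw [← LinearMap.rTensor_comp, h, LinearMap.rTensor_comp]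
  have := congrArg (i.rTensor (C ⊗[k] C)) (LinearMap.congr_fun ρ.coassoc m)
  have e1' := LinearMap.congr_fun e1 (ρ.ρ.rTensor C (ρ.ρ m))
  have e2' := LinearMap.congr_fun e2 (ρ.ρ m)
  have e3' := LinearMap.congr_fun e3 (ρ.ρ m)
  have h' := LinearMap.congr_fun h m
  simp only [LinearMap.comp_apply] at this e1' e2' e3' h' ⊢
  rw [← h', ← e3', ← e1', this, e2']

theorem counit_of_compat (ρ : Coaction k C M) (i : M →ₗ[k] N) (σ : N →ₗ[k] N ⊗[k] C)
    (h : i.rTensor C ∘ₗ ρ.ρ = σ ∘ₗ i) :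
    ((TensorProduct.rid k N).toLinearMap ∘ₗ
      (Coalgebra.counit (R := k) (A := C)).lTensor N ∘ₗ σ) ∘ₗ i = i := by
  apply LinearMap.ext
  intro m
  have e1 : i ∘ₗ (TensorProduct.rid k M).toLinearMap ∘ₗ
      (Coalgebra.counit (R := k) (A := C)).lTensor M =
      (TensorProduct.rid k N).toLinearMap ∘ₗ
        (Coalgebra.counit (R := k) (A := C)).lTensor N ∘ₗ i.rTensor C := by
    ext; simp
  have := congrArg i (LinearMap.congr_fun ρ.counit_comp m)
  have e1' := LinearMap.congr_fun e1 (ρ.ρ m)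
  have h' := LinearMap.congr_fun h m
  simp only [LinearMap.comp_apply, LinearMap.id_apply] at this e1' h' ⊢
  rw [← h', ← e1', this]

/-- If `q : M → N` is surjective and `σ` is compatible with the coaction `ρ` of `M`, then `σ` is a
coaction. -/
def ofSurjective (ρ : Coaction k C M) (q : M →ₗ[k] N) (hq : Function.Surjective q)
    (σ : N →ₗ[k] N ⊗[k] C) (h : q.rTensor C ∘ₗ ρ.ρ = σ ∘ₗ q) : Coaction k C N where
  ρ := σ
  coassoc := (LinearMap.cancel_right hq).1 (ρ.coassoc_of_compat q σ h)
  counit_comp := (LinearMap.cancel_right hq).1 (ρ.counit_of_compat q σ h)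

theorem exists_sub (ρ : Coaction k C M) (W : Submodule k M) (hW : ρ.IsStable W) :
    ∃ σ : W →ₗ[k] W ⊗[k] C, W.subtype.rTensor C ∘ₗ σ = ρ.ρ ∘ₗ W.subtype := by
  have hinj := rTensor_injective W.subtype W.injective_subtype C
  refine ⟨(LinearEquiv.ofInjective _ hinj).symm.toLinearMap ∘ₗ
    (ρ.ρ ∘ₗ W.subtype).codRestrict (LinearMap.range (W.subtype.rTensor C))
      (fun w => hW w w.2), ?_⟩
  apply LinearMap.ext
  intro w
  exact congrArg Subtype.val ((LinearEquiv.ofInjective _ hinj).apply_symm_apply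
    ((ρ.ρ ∘ₗ W.subtype).codRestrict (LinearMap.range (W.subtype.rTensor C))
      (fun w => hW w w.2) w))

/-- The `H`-module structure on a stable submodule `W`: the unique map `W → W ⊗ C` that is
compatible with `ρ`. -/
def sub (ρ : Coaction k C M) (W : Submodule k M) (hW : ρ.IsStable W) : Coaction k C W :=
  ρ.ofInjective W.subtype W.injective_subtype (ρ.exists_sub W hW).choose
    (ρ.exists_sub W hW).choose_spec

theorem sub_spec (ρ : Coaction k C M) (W : Submodule k M) (hW : ρ.IsStable W) :
    (ρ.sub W hW).IsEquivariant ρ W.subtype :=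
  (ρ.exists_sub W hW).choose_spec

theorem inclusion_equivariant (ρ : Coaction k C M) (V W : Submodule k M) (hV : ρ.IsStable V)
    (hW : ρ.IsStable W) (h : V ≤ W) :
    (ρ.sub V hV).IsEquivariant (ρ.sub W hW) (Submodule.inclusion h) := by
  have hinj := rTensor_injective W.subtype W.injective_subtype C
  apply LinearMap.ext
  intro v
  apply hinj
  have h1 := LinearMap.congr_fun (ρ.sub_spec V hV) v
  have h2 := LinearMap.congr_fun (ρ.sub_spec W hW) (Submodule.inclusion h v)
  simp only [LinearMap.comp_apply] at h1 h2 ⊢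
  rw [h2, ← LinearMap.comp_apply, ← LinearMap.rTensor_comp, Submodule.subtype_comp_inclusion, h1]
  rfl

theorem isStable_range (ρ : Coaction k C M) (σ : Coaction k C N) (f : M →ₗ[k] N)
    (hf : ρ.IsEquivariant σ f) : σ.IsStable (LinearMap.range f) := by
  rintro _ ⟨m, rfl⟩
  rw [← LinearMap.comp_apply, ← hf]
  refine ⟨f.rangeRestrict.rTensor C (ρ.ρ m), ?_⟩
  rw [← LinearMap.comp_apply, ← LinearMap.rTensor_comp]
  rfl

theorem isStable_ker (ρ : Coaction k C M) (σ : Coaction k C N) (f : M →ₗ[k] N)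
    (hf : ρ.IsEquivariant σ f) : ρ.IsStable (LinearMap.ker f) := by
  intro m hm
  have hex : Function.Exact ((LinearMap.ker f).subtype.rTensor C) (f.rTensor C) :=
    Module.Flat.rTensor_exact C (LinearMap.exact_subtype_ker_map f)
  refine (hex (ρ.ρ m)).1 ?_
  have := LinearMap.congr_fun hf m
  simp only [LinearMap.comp_apply] at this
  rw [this, LinearMap.mem_ker.1 hm, map_zero]

/-- The `H`-module structure on the quotient of `M` by a stable submodule. -/
def quot (ρ : Coaction k C M) (W : Submodule k M) (hW : ρ.IsStable W) : Coaction k C (M ⧸ W) :=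
  ρ.ofSurjective W.mkQ W.mkQ_surjective
    (W.liftQ (W.mkQ.rTensor C ∘ₗ ρ.ρ) (by
      intro w hw
      obtain ⟨y, hy⟩ := hW w hw
      rw [LinearMap.mem_ker, LinearMap.comp_apply, ← hy, ← LinearMap.comp_apply,
        ← LinearMap.rTensor_comp]
      have : W.mkQ ∘ₗ W.subtype = 0 := by ext; simp
      rw [this, LinearMap.rTensor_zero, LinearMap.zero_apply]))
    (by rw [Submodule.liftQ_mkQ])

theorem quot_spec (ρ : Coaction k C M) (W : Submodule k M) (hW : ρ.IsStable W) :
    ρ.IsEquivariant (ρ.quot W hW) W.mkQ := by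
  unfold IsEquivariant quot ofSurjective
  rw [Submodule.liftQ_mkQ]

/-- The direct sum of two `H`-modules. -/
def prod (ρ : Coaction k C M) (σ : Coaction k C N) : Coaction k C (M × N) where
  ρ := (LinearMap.inl k M N).rTensor C ∘ₗ ρ.ρ ∘ₗ LinearMap.fst k M N +
    (LinearMap.inr k M N).rTensor C ∘ₗ σ.ρ ∘ₗ LinearMap.snd k M N
  coassoc := by
    apply LinearMap.prod_ext
    · exact ρ.coassoc_of_compat _ _ (by ext; simp)
    · exact σ.coassoc_of_compat _ _ (by ext; simp)
  counit_comp := by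
    apply LinearMap.prod_ext
    · exact ρ.counit_of_compat _ _ (by ext; simp)
    · exact σ.counit_of_compat _ _ (by ext; simp)

end Coaction

/-! ### First cohomology, through the Hochschild complex -/

namespace Coaction

/-- The differential `M → M ⊗ C` of the Hochschild complex, `(δm)(g) = g • m - m`. -/
def d0 (ρ : Coaction k C M) : M →ₗ[k] M ⊗[k] C :=
  ρ.ρ - tmulOne k C M

/-- The differential `M ⊗ C → M ⊗ C ⊗ C` of the Hochschild complex. Regarding `c ∈ M ⊗ C` as a
function `H → M`, it is `(δc)(g, h) = g • c(h) - c(gh) + c(g)`. -/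
def d1 (ρ : Coaction k C M) : M ⊗[k] C →ₗ[k] M ⊗[k] (C ⊗[k] C) :=
  (TensorProduct.assoc k M C C).toLinearMap ∘ₗ ρ.ρ.rTensor C
    - (Coalgebra.comul (R := k) (A := C)).lTensor M
    + (tmulOne k C C).lTensor M

theorem d1_comp_d0 (ρ : Coaction k C M) : ρ.d1 ∘ₗ ρ.d0 = 0 := by
  apply LinearMap.ext
  intro m
  have h := LinearMap.congr_fun ρ.coassoc m
  have h2 : (TensorProduct.assoc k M C C) (ρ.ρ m ⊗ₜ 1) =
      (tmulOne k C C).lTensor M (ρ.ρ m) := by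
    induction ρ.ρ m using TensorProduct.induction_on with
    | zero => simp
    | tmul x y => simp
    | add x y hx hy => simp only [TensorProduct.add_tmul, map_add, hx, hy]
  simp only [LinearMap.comp_apply, LinearEquiv.coe_coe] at h
  simp only [d1, d0, LinearMap.comp_apply, LinearMap.sub_apply, LinearMap.add_apply, map_sub,
    LinearEquiv.coe_coe, h, tmulOne_apply, LinearMap.rTensor_tmul, h2, LinearMap.lTensor_tmul,
    Bialgebra.comul_one, Algebra.TensorProduct.one_def, LinearMap.zero_apply]
  abel

/-- `H¹(H, M)`: cocycles modulo coboundaries. -/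
def H1 (ρ : Coaction k C M) : Type u :=
  LinearMap.ker ρ.d1 ⧸ (LinearMap.range ρ.d0).comap (LinearMap.ker ρ.d1).subtype

instance (ρ : Coaction k C M) : AddCommGroup ρ.H1 :=
  inferInstanceAs (AddCommGroup (_ ⧸ _))

instance (ρ : Coaction k C M) : Module k ρ.H1 :=
  inferInstanceAs (Module k (LinearMap.ker ρ.d1 ⧸ _))

/-- The class in `H¹(H, M)` of a cocycle. -/
def H1.mk (ρ : Coaction k C M) : LinearMap.ker ρ.d1 →ₗ[k] ρ.H1 :=
  Submodule.mkQ ((LinearMap.range ρ.d0).comap (LinearMap.ker ρ.d1).subtype)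

theorem d0_compat (ρ : Coaction k C M) (σ : Coaction k D M) (f : C →ₐc[k] D)
    (h : σ.ρ = (ρ.res f).ρ) :
    σ.d0 = (f : C →ₗ[k] D).lTensor M ∘ₗ ρ.d0 := by
  apply LinearMap.ext
  intro m
  simp [d0, h, res]

theorem d1_compat (ρ : Coaction k C M) (σ : Coaction k D M) (f : C →ₐc[k] D)
    (h : σ.ρ = (ρ.res f).ρ) :
    σ.d1 ∘ₗ (f : C →ₗ[k] D).lTensor M =
      (TensorProduct.map (f : C →ₗ[k] D) (f : C →ₗ[k] D)).lTensor M ∘ₗ ρ.d1 := by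
  have h2 : TensorProduct.map (f : C →ₗ[k] D) (f : C →ₗ[k] D) ∘ₗ Coalgebra.comul =
      Coalgebra.comul ∘ₗ (f : C →ₗ[k] D) := CoalgHomClass.map_comp_comul f
  ext m c
  have h3 : Coalgebra.comul (R := k) (f c) =
      TensorProduct.map (f : C →ₗ[k] D) (f : C →ₗ[k] D) (Coalgebra.comul (R := k) c) :=
    (LinearMap.congr_fun h2 c).symm
  have h4 : (TensorProduct.assoc k M D D) ((f : C →ₗ[k] D).lTensor M (ρ.ρ m) ⊗ₜ[k] f c) =
      (TensorProduct.map (f : C →ₗ[k] D) (f : C →ₗ[k] D)).lTensor M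
        ((TensorProduct.assoc k M C C) (ρ.ρ m ⊗ₜ c)) := by
    induction ρ.ρ m using TensorProduct.induction_on with
    | zero => simp
    | tmul x y => simp
    | add x y hx hy => simp only [TensorProduct.add_tmul, map_add, hx, hy]
  have h5 : TensorProduct.map (f : C →ₗ[k] D) (f : C →ₗ[k] D) (c ⊗ₜ[k] (1 : C)) =
      f c ⊗ₜ[k] (1 : D) := by simp
  simp only [d1, h, res, TensorProduct.AlgebraTensorModule.curry_apply, TensorProduct.curry_apply,
    LinearMap.restrictScalars_self, LinearMap.comp_apply, LinearMap.lTensor_tmul,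
    LinearMap.add_apply, LinearMap.sub_apply, LinearMap.rTensor_tmul, LinearEquiv.coe_coe,
    map_add, map_sub, tmulOne_apply, h5, ← h4]
  rw [← h3]
  rfl

/-- The restriction map `H¹(H, M) → H¹(H', M)` for a homomorphism `H' → H` with comorphism `f`,
where the `H'`-module structure `σ` on `M` is the restriction of `ρ`. -/
def H1.res (ρ : Coaction k C M) (σ : Coaction k D M) (f : C →ₐc[k] D)
    (h : σ.ρ = (ρ.res f).ρ) : ρ.H1 →ₗ[k] σ.H1 :=
  Submodule.mapQ ((LinearMap.range ρ.d0).comap (LinearMap.ker ρ.d1).subtype)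
    ((LinearMap.range σ.d0).comap (LinearMap.ker σ.d1).subtype)
    (((f : C →ₗ[k] D).lTensor M).restrict (p := LinearMap.ker ρ.d1) (q := LinearMap.ker σ.d1)
      (by
        intro c hc
        have := LinearMap.congr_fun (d1_compat ρ σ f h) c
        simp only [LinearMap.comp_apply] at this
        rw [LinearMap.mem_ker, this, LinearMap.mem_ker.1 hc, map_zero]))
    (by
      rintro ⟨c, hc⟩ ⟨m, hm⟩
      refine ⟨m, ?_⟩
      have := LinearMap.congr_fun (d0_compat ρ σ f h) m
      rw [this, LinearMap.comp_apply, hm]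
      rfl)

theorem res_res_ρ {D' : Type u} [CommRing D'] [Bialgebra k D'] (ρ : Coaction k C M)
    (f : C →ₐc[k] D) (g : D →ₐc[k] D') (e : C →ₐc[k] D') (he : ∀ x, g (f x) = e x) :
    (ρ.res e).ρ = ((ρ.res f).res g).ρ := by
  have h : (e : C →ₗ[k] D') = (g : D →ₗ[k] D') ∘ₗ (f : C →ₗ[k] D) :=
    LinearMap.ext fun x => (he x).symm
  change (e : C →ₗ[k] D').lTensor M ∘ₗ ρ.ρ =
    (g : D →ₗ[k] D').lTensor M ∘ₗ (f : C →ₗ[k] D).lTensor M ∘ₗ ρ.ρ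
  rw [h, LinearMap.lTensor_comp, LinearMap.comp_assoc]

theorem H1.res_mk (ρ : Coaction k C M) (σ : Coaction k D M) (f : C →ₐc[k] D)
    (h : σ.ρ = (ρ.res f).ρ) (z : LinearMap.ker ρ.d1) (z' : LinearMap.ker σ.d1)
    (hz : (z' : M ⊗[k] D) = (f : C →ₗ[k] D).lTensor M (z : M ⊗[k] C)) :
    H1.res ρ σ f h (H1.mk ρ z) = H1.mk σ z' :=
  congrArg (H1.mk σ) (Subtype.ext hz.symm)

theorem H1.res_res {D' : Type u} [CommRing D'] [Bialgebra k D'] (ρ : Coaction k C M)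
    (σ : Coaction k D M) (τ : Coaction k D' M) (f : C →ₐc[k] D) (g : D →ₐc[k] D')
    (e : C →ₐc[k] D') (he : ∀ x, g (f x) = e x) (hf : σ.ρ = (ρ.res f).ρ)
    (hg : τ.ρ = (σ.res g).ρ) (hh : τ.ρ = (ρ.res e).ρ) (ξ : ρ.H1) :
    H1.res σ τ g hg (H1.res ρ σ f hf ξ) = H1.res ρ τ e hh ξ := by
  obtain ⟨z, rfl⟩ : ∃ z, H1.mk ρ z = ξ := Submodule.mkQ_surjective _ ξ
  have h : (e : C →ₗ[k] D') = (g : D →ₗ[k] D') ∘ₗ (f : C →ₗ[k] D) :=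
    LinearMap.ext fun x => (he x).symm
  have hz : (f : C →ₗ[k] D).lTensor M (z : M ⊗[k] C) ∈ LinearMap.ker σ.d1 := by
    have := LinearMap.congr_fun (d1_compat ρ σ f hf) z
    simp only [LinearMap.comp_apply] at this
    rw [LinearMap.mem_ker, this, LinearMap.mem_ker.1 z.2, map_zero]
  have hz' : (e : C →ₗ[k] D').lTensor M (z : M ⊗[k] C) ∈ LinearMap.ker τ.d1 := by
    have := LinearMap.congr_fun (d1_compat ρ τ e hh) z
    simp only [LinearMap.comp_apply] at this
    rw [LinearMap.mem_ker, this, LinearMap.mem_ker.1 z.2, map_zero]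
  rw [H1.res_mk ρ σ f hf z ⟨_, hz⟩ rfl, H1.res_mk ρ τ e hh z ⟨_, hz'⟩ rfl]
  refine H1.res_mk σ τ g hg ⟨_, hz⟩ ⟨_, hz'⟩ ?_
  change (e : C →ₗ[k] D').lTensor M _ = _
  rw [h, LinearMap.lTensor_comp, LinearMap.comp_apply]

end Coaction

/-! ### Extensions of `k` -/

/-- An extension `0 → M → E → k → 0` of `H`-modules. -/
structure Extension (ρ : Coaction k C M) where
  E : Type u
  [addCommGroup : AddCommGroup E]
  [module : Module k E]
  coaction : Coaction k C E
  i : M →ₗ[k] E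
  p : E →ₗ[k] k
  i_equivariant : ρ.IsEquivariant coaction i
  p_equivariant : coaction.IsEquivariant (Coaction.trivial k C k) p
  i_injective : Function.Injective i
  exact : Function.Exact i p
  p_surjective : Function.Surjective p

attribute [instance] Extension.addCommGroup Extension.module

namespace Extension

/-- The extension splits: `p` has an `H`-equivariant section. -/
def Splits {ρ : Coaction k C M} (X : Extension ρ) : Prop :=
  ∃ s : k →ₗ[k] X.E, (Coaction.trivial k C k).IsEquivariant X.coaction s ∧
    X.p ∘ₗ s = LinearMap.id

/-- `ξ ∈ H¹(H, M)` is the class of the extension, i.e. the image of `1 ∈ k` under the connecting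
homomorphism: it is represented by the cocycle `g ↦ g • e - e` for a lift `e` of `1`. -/
def HasClass {ρ : Coaction k C M} (X : Extension ρ) (ξ : ρ.H1) : Prop :=
  ∃ (e : X.E) (z : LinearMap.ker ρ.d1), X.p e = 1 ∧
    X.i.rTensor C (z : M ⊗[k] C) = X.coaction.d0 e ∧ Coaction.H1.mk ρ z = ξ

theorem res_equivariant {ρ : Coaction k C M} {σ : Coaction k C N} {g : M →ₗ[k] N}
    (hg : ρ.IsEquivariant σ g) (f : C →ₐc[k] D) : (ρ.res f).IsEquivariant (σ.res f) g := by
  unfold Coaction.IsEquivariant Coaction.res at *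
  dsimp only
  have e : g.rTensor D ∘ₗ (f : C →ₗ[k] D).lTensor M =
      (f : C →ₗ[k] D).lTensor N ∘ₗ g.rTensor C := by
    ext; simp
  rw [← LinearMap.comp_assoc, e, LinearMap.comp_assoc, hg, LinearMap.comp_assoc]

/-- Restriction of an extension along a homomorphism `H' → H` with comorphism `f`. -/
def res {ρ : Coaction k C M} (X : Extension ρ) (f : C →ₐc[k] D) : Extension (ρ.res f) where
  E := X.E
  coaction := X.coaction.res f
  i := X.i
  p := X.p
  i_equivariant := res_equivariant X.i_equivariant f
  p_equivariant := by
    have h := res_equivariant X.p_equivariant f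
    have e : ((Coaction.trivial k C k).res f).ρ = (Coaction.trivial k D k).ρ := by
      ext; simp [Coaction.res, Coaction.trivial]
    unfold Coaction.IsEquivariant at h ⊢
    rw [h, e]
  i_injective := X.i_injective
  exact := X.exact
  p_surjective := X.p_surjective

section Pullback

variable (ρ : Coaction k C M) (σ : Coaction k C N) (i : M →ₗ[k] N) (hi : ρ.IsEquivariant σ i)

/-- The `H`-module `N / M`, for an equivariant `i : M → N`. -/
abbrev quotByImage : Coaction k C (N ⧸ LinearMap.range i) :=
  σ.quot (LinearMap.range i) (ρ.isStable_range σ i hi)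

/-- The map `N ⊕ k → N / M`, `(n, t) ↦ [n] - t q`. -/
def pullbackMap (q : N ⧸ LinearMap.range i) : N × k →ₗ[k] N ⧸ LinearMap.range i :=
  (LinearMap.range i).mkQ ∘ₗ LinearMap.fst k N k -
    (LinearMap.toSpanSingleton k _ q) ∘ₗ LinearMap.snd k N k

theorem pullbackMap_equivariant (q : N ⧸ LinearMap.range i)
    (hq : q ∈ (quotByImage ρ σ i hi).invariants) :
    (σ.prod (Coaction.trivial k C k)).IsEquivariant (quotByImage ρ σ i hi)
      (pullbackMap i q) := by
  have h1 := σ.quot_spec (LinearMap.range i) (ρ.isStable_range σ i hi)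
  have hq' : (quotByImage ρ σ i hi).ρ q = q ⊗ₜ 1 := hq
  apply LinearMap.prod_ext
  · apply LinearMap.ext
    intro n
    have h1' := LinearMap.congr_fun h1 n
    have e : pullbackMap i q ∘ₗ LinearMap.inl k N k = (LinearMap.range i).mkQ := by
      ext; simp [pullbackMap]
    have h2 : (pullbackMap i q).rTensor C ((LinearMap.inl k N k).rTensor C (σ.ρ n)) =
        (LinearMap.range i).mkQ.rTensor C (σ.ρ n) := by
      rw [← LinearMap.comp_apply, ← LinearMap.rTensor_comp, e]
    have h3 : pullbackMap i q (n, 0) = (LinearMap.range i).mkQ n := LinearMap.congr_fun e n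
    simp only [LinearMap.comp_apply] at h1'
    simp [Coaction.prod, h2, h3]
    exact h1'
  · ext
    simp [Coaction.prod, Coaction.trivial, pullbackMap, hq']

/-- Given a short exact sequence `0 → M → N → N/M → 0` of `H`-modules and an invariant `q` of
`N / M`, the pullback of the sequence along `k → N / M`, `1 ↦ q`. -/
def pullback (hinj : Function.Injective i) (q : N ⧸ LinearMap.range i)
    (hq : q ∈ (quotByImage ρ σ i hi).invariants) : Extension ρ where
  E := LinearMap.ker (pullbackMap i q)
  coaction := (σ.prod (Coaction.trivial k C k)).sub (LinearMap.ker (pullbackMap i q))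
    (Coaction.isStable_ker _ _ _ (pullbackMap_equivariant ρ σ i hi q hq))
  i := (LinearMap.inl k N k ∘ₗ i).codRestrict (LinearMap.ker (pullbackMap i q)) (by
    intro m
    simp [pullbackMap])
  p := LinearMap.snd k N k ∘ₗ (LinearMap.ker (pullbackMap i q)).subtype
  i_equivariant := by
    have hst := Coaction.isStable_ker _ _ _ (pullbackMap_equivariant ρ σ i hi q hq)
    have hs := (σ.prod (Coaction.trivial k C k)).sub_spec (LinearMap.ker (pullbackMap i q)) hst
    apply LinearMap.ext
    intro m
    apply Coaction.rTensor_injective _ (LinearMap.ker (pullbackMap i q)).injective_subtype C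
    rw [← LinearMap.comp_apply, ← LinearMap.comp_assoc, ← LinearMap.rTensor_comp,
      ← LinearMap.comp_apply (f := (LinearMap.ker (pullbackMap i q)).subtype.rTensor C),
      ← LinearMap.comp_assoc, hs]
    have hm : (LinearMap.ker (pullbackMap i q)).subtype ∘ₗ (LinearMap.inl k N k ∘ₗ i).codRestrict
        (LinearMap.ker (pullbackMap i q)) (by intro m; simp [pullbackMap]) =
        LinearMap.inl k N k ∘ₗ i := rfl
    rw [LinearMap.comp_assoc, hm, LinearMap.rTensor_comp, LinearMap.comp_assoc, hi]
    simp [Coaction.prod]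
  p_equivariant := by
    have hst := Coaction.isStable_ker _ _ _ (pullbackMap_equivariant ρ σ i hi q hq)
    have hs := (σ.prod (Coaction.trivial k C k)).sub_spec (LinearMap.ker (pullbackMap i q)) hst
    have h2 : (σ.prod (Coaction.trivial k C k)).IsEquivariant (Coaction.trivial k C k)
        (LinearMap.snd k N k) := by
      have e1 : (LinearMap.snd k N k).rTensor C ∘ₗ (LinearMap.inl k N k).rTensor C = 0 := by
        rw [← LinearMap.rTensor_comp, LinearMap.snd_comp_inl, LinearMap.rTensor_zero]
      have e2 : (LinearMap.snd k N k).rTensor C ∘ₗ (LinearMap.inr k N k).rTensor C =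
          LinearMap.id := by
        rw [← LinearMap.rTensor_comp, LinearMap.snd_comp_inr, LinearMap.rTensor_id]
      unfold Coaction.IsEquivariant Coaction.prod
      rw [LinearMap.comp_add, ← LinearMap.comp_assoc, e1,
        ← LinearMap.comp_assoc _ _ ((LinearMap.snd k N k).rTensor C), e2,
        LinearMap.zero_comp, zero_add, LinearMap.id_comp]
    unfold Coaction.IsEquivariant at h2 hs ⊢
    rw [LinearMap.rTensor_comp, LinearMap.comp_assoc, hs, ← LinearMap.comp_assoc, h2,
      LinearMap.comp_assoc]
  i_injective := by
    intro x y h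
    apply hinj
    exact congrArg (fun z : LinearMap.ker (pullbackMap i q) => (z : N × k).1) h
  exact := by
    rintro ⟨⟨n, t⟩, h⟩
    constructor
    · intro (ht : t = 0)
      subst ht
      simp [pullbackMap] at h
      obtain ⟨m, rfl⟩ := h
      exact ⟨m, rfl⟩
    · rintro ⟨m, hm⟩
      exact (congrArg (fun z : LinearMap.ker (pullbackMap i q) => (z : N × k).2) hm).symm
  p_surjective := by
    intro t
    obtain ⟨n, hn⟩ := (LinearMap.range i).mkQ_surjective (t • q)
    refine ⟨⟨(n, t), ?_⟩, rfl⟩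
    rw [LinearMap.mem_ker]
    simp only [pullbackMap, LinearMap.sub_apply, LinearMap.comp_apply, LinearMap.fst_apply,
      LinearMap.snd_apply, LinearMap.toSpanSingleton_apply, hn, sub_self]

end Pullback

end Extension

end Comodules

/-! ### Frobenius kernels -/

noncomputable section Frobenius

variable (k C : Type u) [Field k] [CommRing C] [Bialgebra k C] (p : ℕ)

/-- The ideal of `k[H]` defining the `r`-th Frobenius kernel `H_r`, generated by the `p ^ r`-th
powers of the functions that vanish at the identity. -/
def frobeniusIdeal (r : ℕ) : Ideal C :=
  Ideal.span {x | ∃ f : C, Coalgebra.counit (R := k) f = 0 ∧ x = f ^ p ^ r}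

theorem frobeniusIdeal_anti [Fact p.Prime] {r s : ℕ} (h : r ≤ s) :
    frobeniusIdeal k C p s ≤ frobeniusIdeal k C p r := by
  refine Ideal.span_le.2 ?_
  rintro _ ⟨f, hf, rfl⟩
  obtain ⟨t, rfl⟩ := Nat.exists_eq_add_of_le h
  refine Ideal.subset_span ⟨f ^ p ^ t, ?_, ?_⟩
  · have h0 := map_pow (Bialgebra.counitAlgHom k C) f (p ^ t)
    simp only [Bialgebra.counitAlgHom_apply, hf] at h0
    rw [h0, zero_pow (pow_ne_zero _ (Fact.out : p.Prime).ne_zero)]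
  · rw [← pow_mul, ← pow_add, add_comm]

variable [Fact p.Prime] [CharP k p]

theorem add_pow_of_algebra (k : Type u) {S : Type u} [Field k] [CommRing S] [Algebra k S]
    (p : ℕ) [Fact p.Prime] [CharP k p] (r : ℕ) (x y : S) :
    (x + y) ^ p ^ r = x ^ p ^ r + y ^ p ^ r := by
  cases subsingleton_or_nontrivial S with
  | inl h => exact Subsingleton.elim _ _
  | inr h =>
    have := charP_of_injective_algebraMap (algebraMap k S).injective p
    exact add_pow_char_pow ..

instance frobeniusIdeal_isCoideal (r : ℕ) :
    ((frobeniusIdeal k C p r).restrictScalars k).IsCoideal where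
  counit_eq_zero := by
    intro x hx
    have : frobeniusIdeal k C p r ≤ RingHom.ker (Bialgebra.counitAlgHom k C) := by
      refine Ideal.span_le.2 ?_
      rintro _ ⟨f, hf, rfl⟩
      simp [hf, (Fact.out : p.Prime).ne_zero]
    exact this hx
  map_mkQ_comul_eq_zero := by
    intro x hx
    set I := frobeniusIdeal k C p r with hI
    let π := Ideal.Quotient.mkₐ k I
    let φ : C →ₐ[k] (C ⧸ I) ⊗[k] (C ⧸ I) :=
      (Algebra.TensorProduct.map π π).comp (Bialgebra.comulAlgHom k C)
    have hπ : ∀ f : C, π f ^ p ^ r =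
        algebraMap k (C ⧸ I) (Coalgebra.counit (R := k) f ^ p ^ r) := by
      intro f
      have hc : Coalgebra.counit (R := k)
          (f - algebraMap k C (Coalgebra.counit (R := k) f)) = 0 := by
        simp
      have h0 : π ((f - algebraMap k C (Coalgebra.counit (R := k) f)) ^ p ^ r) = 0 :=
        Ideal.Quotient.eq_zero_iff_mem.2 (Ideal.subset_span ⟨_, hc, rfl⟩)
      have h1 := add_pow_of_algebra k p r (π (f - algebraMap k C (Coalgebra.counit (R := k) f)))
        (π (algebraMap k C (Coalgebra.counit (R := k) f)))
      rw [← map_add, sub_add_cancel, ← map_pow π (f - _), h0, zero_add, AlgHom.commutes] at h1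
      exact h1.trans (map_pow (algebraMap k (C ⧸ I)) _ _).symm
    -- the Frobenius twist of `φ` factors through the counit
    have hφ : ∀ z : C ⊗[k] C, Algebra.TensorProduct.map π π z ^ p ^ r =
        algebraMap k _ (Coalgebra.counit (R := k) (LinearMap.mul' k C z) ^ p ^ r) := by
      intro z
      induction z using TensorProduct.induction_on with
      | zero => simp [(Fact.out : p.Prime).ne_zero]
      | tmul x y =>
        rw [Algebra.TensorProduct.map_tmul, Algebra.TensorProduct.tmul_pow, hπ, hπ,
          LinearMap.mul'_apply, Bialgebra.counit_mul, mul_pow, Algebra.algebraMap_eq_smul_one,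
          Algebra.algebraMap_eq_smul_one, Algebra.algebraMap_eq_smul_one,
          TensorProduct.smul_tmul_smul, Algebra.TensorProduct.one_def]
      | add x y hx hy =>
        rw [map_add, add_pow_of_algebra k, hx, hy, map_add, map_add, add_pow_of_algebra k, map_add]
    have hε : ∀ f : C, Coalgebra.counit (R := k) (LinearMap.mul' k C (Coalgebra.comul f)) =
        Coalgebra.counit (R := k) f := by
      intro f
      have h1 : ∀ z : C ⊗[k] C, Coalgebra.counit (R := k) (LinearMap.mul' k C z) =
          Coalgebra.counit (R := k) (TensorProduct.lid k C
            ((Coalgebra.counit (R := k) (A := C)).rTensor C z)) := by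
        intro z
        induction z using TensorProduct.induction_on with
        | zero => simp
        | tmul x y => simp
        | add x y hx hy => simp only [map_add, hx, hy]
      rw [h1, Coalgebra.rTensor_counit_comul]
      simp
    have : I ≤ RingHom.ker φ := by
      refine Ideal.span_le.2 ?_
      rintro _ ⟨f, hf, rfl⟩
      change φ (f ^ p ^ r) = 0
      rw [map_pow]
      change Algebra.TensorProduct.map π π (Coalgebra.comul f) ^ p ^ r = 0
      rw [hφ, hε, hf, zero_pow (pow_ne_zero _ (Fact.out : p.Prime).ne_zero), map_zero]
    exact this hx

/-- The coordinate bialgebra `k[H_r]` of the `r`-th Frobenius kernel of `H`. -/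
abbrev FrobeniusKernel (r : ℕ) : Type u := C ⧸ frobeniusIdeal k C p r

/-- The comorphism `k[H] → k[H_r]` of the inclusion `H_r → H`. -/
def toFrobeniusKernel (r : ℕ) : C →ₐc[k] FrobeniusKernel k C p r :=
  Bialgebra.Quotient.mkBialgHom _

/-- The comorphism `k[H_s] → k[H_r]` of the inclusion `H_r → H_s`, for `r ≤ s`. -/
def frobeniusKernelMap {r s : ℕ} (h : r ≤ s) :
    FrobeniusKernel k C p s →ₐc[k] FrobeniusKernel k C p r :=
  .ofAlgHom (Ideal.Quotient.factorₐ k (frobeniusIdeal_anti k C p h))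
    (by
      apply AlgHom.ext
      intro x
      obtain ⟨x, rfl⟩ := Ideal.Quotient.mk_surjective x
      rw [AlgHom.comp_apply, Ideal.Quotient.factorₐ_apply_mk, Bialgebra.counitAlgHom_apply,
        Bialgebra.counitAlgHom_apply, Bialgebra.Quotient.counit_mk,
        Bialgebra.Quotient.counit_mk])
    (by
      apply AlgHom.ext
      intro x
      obtain ⟨x, rfl⟩ := Ideal.Quotient.mk_surjective x
      rw [AlgHom.comp_apply, AlgHom.comp_apply, Ideal.Quotient.factorₐ_apply_mk,
        Bialgebra.comulAlgHom_apply,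
        Bialgebra.comulAlgHom_apply, Bialgebra.Quotient.comul_mk,
        Bialgebra.Quotient.comul_mk]
      induction (Coalgebra.comul (R := k) x) using TensorProduct.induction_on with
      | zero => rw [map_zero, map_zero, map_zero]
      | tmul a b => rfl
      | add a b ha hb => rw [map_add, map_add, ha, hb, map_add])

theorem frobeniusKernelMap_toFrobeniusKernel {r s : ℕ} (h : r ≤ s) (x : C) :
    frobeniusKernelMap k C p h (toFrobeniusKernel k C p s x) = toFrobeniusKernel k C p r x :=
  rfl

end Frobenius

noncomputable section Limit

variable {k C M : Type u} [Field k] [CommRing C] [Bialgebra k C] [AddCommGroup M] [Module k M]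
  (p : ℕ) [Fact p.Prime] [CharP k p]

/-- The restriction of an `H`-module to the Frobenius kernel `H_r`. -/
abbrev Coaction.resFrob (ρ : Coaction k C M) (r : ℕ) : Coaction k (FrobeniusKernel k C p r) M :=
  ρ.res (toFrobeniusKernel k C p r)

/-- The restriction map `H¹(H, M) → H¹(H_r, M)`. -/
def H1.toFrob (ρ : Coaction k C M) (r : ℕ) : ρ.H1 →ₗ[k] (ρ.resFrob p r).H1 :=
  Coaction.H1.res ρ (ρ.resFrob p r) (toFrobeniusKernel k C p r) rfl

theorem resFrob_compat (ρ : Coaction k C M) {r s : ℕ} (h : r ≤ s) :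
    (ρ.resFrob p r).ρ = ((ρ.resFrob p s).res (frobeniusKernelMap k C p h)).ρ :=
  Coaction.res_res_ρ ρ _ _ _ (frobeniusKernelMap_toFrobeniusKernel k C p h)

/-- The restriction map `H¹(H_s, M) → H¹(H_r, M)`, for `r ≤ s`. -/
def H1.frobTransition (ρ : Coaction k C M) {r s : ℕ} (h : r ≤ s) :
    (ρ.resFrob p s).H1 →ₗ[k] (ρ.resFrob p r).H1 :=
  Coaction.H1.res (ρ.resFrob p s) (ρ.resFrob p r) (frobeniusKernelMap k C p h)
    (resFrob_compat p ρ h)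

theorem H1.frobTransition_toFrob (ρ : Coaction k C M) {r s : ℕ} (h : r ≤ s) (ξ : ρ.H1) :
    H1.frobTransition p ρ h (H1.toFrob p ρ s ξ) = H1.toFrob p ρ r ξ :=
  Coaction.H1.res_res ρ _ _ _ _ _ (frobeniusKernelMap_toFrobeniusKernel k C p h) _ _ _ ξ

/-- The inverse limit of the `H¹(H_r, M)`, `r ≥ 1`. -/
def H1.frobLimit (ρ : Coaction k C M) : Submodule k (∀ r : ℕ+, (ρ.resFrob p r).H1) where
  carrier := {x | ∀ (r s : ℕ+) (h : r ≤ s), H1.frobTransition p ρ h (x s) = x r}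
  add_mem' := by
    intro x y hx hy r s h
    exact (map_add _ _ _).trans (congrArg₂ (· + ·) (hx r s h) (hy r s h))
  zero_mem' := by
    intro r s h
    exact map_zero _
  smul_mem' := by
    intro c x hx r s h
    exact (map_smul _ _ _).trans (congrArg (c • ·) (hx r s h))

/-- The canonical map from `H¹(H, M)` to the inverse limit of the `H¹(H_r, M)`. -/
def H1.toFrobLimit (ρ : Coaction k C M) : ρ.H1 →ₗ[k] H1.frobLimit p ρ :=
  (LinearMap.pi fun r : ℕ+ => H1.toFrob p ρ r).codRestrict (H1.frobLimit p ρ)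
    (fun ξ _ _ h => H1.frobTransition_toFrob p ρ h ξ)

end Limit

/-! ### The group scheme `SL₂` -/

noncomputable section SL2

/-- The coordinate ring `k[a, b, c, d] / (ad - bc - 1)` of `SL₂`. -/
def SL2Ring (k : Type u) [Field k] : Type u :=
  MvPolynomial (Fin 2 × Fin 2) k ⧸
    Ideal.span {(MvPolynomial.X (0, 0) * MvPolynomial.X (1, 1) -
      MvPolynomial.X (0, 1) * MvPolynomial.X (1, 0) - 1 : MvPolynomial (Fin 2 × Fin 2) k)}

variable (k : Type u) [Field k]

instance : CommRing (SL2Ring k) := inferInstanceAs (CommRing (_ ⧸ _))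

instance : Algebra k (SL2Ring k) :=
  inferInstanceAs (Algebra k (MvPolynomial (Fin 2 × Fin 2) k ⧸ _))

namespace SL2Ring

/-- The quotient map `k[a, b, c, d] → k[SL₂]`. -/
def proj : MvPolynomial (Fin 2 × Fin 2) k →ₐ[k] SL2Ring k :=
  Ideal.Quotient.mkₐ k _

/-- The coordinate functions on `SL₂`. -/
def coord (i j : Fin 2) : SL2Ring k := proj k (MvPolynomial.X (i, j))

theorem coord_det :
    coord k 0 0 * coord k 1 1 - coord k 0 1 * coord k 1 0 = 1 := by
  rw [← sub_eq_zero]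
  have : proj k (MvPolynomial.X (0, 0) * MvPolynomial.X (1, 1) -
      MvPolynomial.X (0, 1) * MvPolynomial.X (1, 0) - 1) = 0 :=
    Ideal.Quotient.eq_zero_iff_mem.2 (Ideal.subset_span rfl)
  simpa only [coord, map_sub, map_mul, map_one] using this

/-- The universal element `!![a, b; c, d]` of `SL₂(k[SL₂])`. -/
def univ : SL(2, SL2Ring k) :=
  ⟨Matrix.of (coord k), by rw [Matrix.det_fin_two]; exact coord_det k⟩

variable {k} {A B : Type u} [CommRing A] [Algebra k A] [CommRing B] [Algebra k B]

/-- The map `SL₂(A) → SL₂(B)` induced by a homomorphism `A → B` of `k`-algebras. -/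
abbrev mapSL (φ : A →ₐ[k] B) : SL(2, A) →* SL(2, B) :=
  Matrix.SpecialLinearGroup.map (φ : A →+* B)

/-- Evaluation `f ↦ f(g)` of functions `f ∈ k[SL₂]` at a point `g ∈ SL₂(A)`. -/
def eval (g : SL(2, A)) : SL2Ring k →ₐ[k] A :=
  Ideal.Quotient.liftₐ _ (MvPolynomial.aeval fun ij : Fin 2 × Fin 2 => g ij.1 ij.2) (by
    intro x hx
    have h : Ideal.span {(MvPolynomial.X (0, 0) * MvPolynomial.X (1, 1) -
        MvPolynomial.X (0, 1) * MvPolynomial.X (1, 0) - 1 : MvPolynomial (Fin 2 × Fin 2) k)} ≤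
        RingHom.ker (MvPolynomial.aeval (R := k) fun ij : Fin 2 × Fin 2 => g ij.1 ij.2) := by
      rw [Ideal.span_le, Set.singleton_subset_iff]
      have := g.det_coe
      rw [Matrix.det_fin_two] at this
      simp [this]
    exact h hx)

@[simp] theorem eval_coord (g : SL(2, A)) (i j : Fin 2) : eval g (coord k i j) = g i j := by
  change MvPolynomial.aeval (fun ij : Fin 2 × Fin 2 => g ij.1 ij.2) (MvPolynomial.X (i, j)) = _
  rw [MvPolynomial.aeval_X]

theorem hom_ext {φ ψ : SL2Ring k →ₐ[k] A} (h : mapSL φ (univ k) = mapSL ψ (univ k)) : φ = ψ := by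
  apply Ideal.Quotient.algHom_ext
  apply MvPolynomial.algHom_ext
  rintro ⟨i, j⟩
  exact congrFun (congrFun (congrArg Subtype.val h) i) j

@[simp] theorem mapSL_eval (g : SL(2, A)) : mapSL (eval g) (univ k) = g := by
  ext i j
  exact eval_coord g i j

theorem mapSL_comp_apply {A' : Type u} [CommRing A'] [Algebra k A'] (φ : A →ₐ[k] B)
    (ψ : B →ₐ[k] A') (g : SL(2, A)) : mapSL (ψ.comp φ) g = mapSL ψ (mapSL φ g) := rfl

theorem comp_eval (φ : A →ₐ[k] B) (g : SL(2, A)) : φ.comp (eval g) = eval (mapSL φ g) := by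
  apply hom_ext
  rw [mapSL_comp_apply, mapSL_eval, mapSL_eval]

variable (k)

/-- The image of the universal element under `k[SL₂] → k[SL₂] ⊗ R`, `f ↦ f ⊗ 1`. -/
abbrev univL (R : Type u) [CommRing R] [Algebra k R] : SL(2, SL2Ring k ⊗[k] R) :=
  mapSL (Algebra.TensorProduct.includeLeft : SL2Ring k →ₐ[k] SL2Ring k ⊗[k] R) (univ k)

/-- The image of the universal element under `k[SL₂] → R ⊗ k[SL₂]`, `f ↦ 1 ⊗ f`. -/
abbrev univR (R : Type u) [CommRing R] [Algebra k R] : SL(2, R ⊗[k] SL2Ring k) :=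
  mapSL (Algebra.TensorProduct.includeRight : SL2Ring k →ₐ[k] R ⊗[k] SL2Ring k) (univ k)

/-- The comultiplication: `Δ f (g, h) = f (g h)`. -/
def comulHom : SL2Ring k →ₐ[k] SL2Ring k ⊗[k] SL2Ring k :=
  eval (univL k (SL2Ring k) * univR k (SL2Ring k))

/-- The counit: `ε f = f 1`. -/
def counitHom : SL2Ring k →ₐ[k] k := eval (1 : SL(2, k))

theorem comulHom_coord (i j : Fin 2) :
    comulHom k (coord k i j) = ∑ l, coord k i l ⊗ₜ[k] coord k l j := by
  rw [comulHom, eval_coord, Matrix.SpecialLinearGroup.coe_mul, Matrix.mul_apply]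
  refine Finset.sum_congr rfl fun l _ => ?_
  change (coord k i l ⊗ₜ[k] (1 : SL2Ring k)) * ((1 : SL2Ring k) ⊗ₜ[k] coord k l j) = _
  rw [Algebra.TensorProduct.tmul_mul_tmul, mul_one, one_mul]

theorem counitHom_coord (i j : Fin 2) : counitHom k (coord k i j) = if i = j then 1 else 0 := by
  rw [counitHom, eval_coord, Matrix.SpecialLinearGroup.coe_one, Matrix.one_apply]

theorem hom_ext' {φ ψ : SL2Ring k →ₐ[k] A} (h : ∀ i j, φ (coord k i j) = ψ (coord k i j)) :
    φ = ψ := by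
  apply hom_ext
  ext i j
  exact h i j

instance : Bialgebra k (SL2Ring k) :=
  Bialgebra.ofAlgHom (comulHom k) (counitHom k)
    (by
      apply hom_ext'
      intro i j
      simp [comulHom_coord, TensorProduct.tmul_add, TensorProduct.add_tmul]
      abel)
    (by
      apply hom_ext'
      intro i j
      fin_cases i <;> simp [comulHom_coord, counitHom_coord])
    (by
      apply hom_ext'
      intro i j
      fin_cases j <;> simp [comulHom_coord, counitHom_coord])

/-- The algebra homomorphism `k[SL₂] → k[SL₂] ⊗ k[SL₂]`, `f ↦ ((x, g) ↦ f (g⁻¹ x))`. -/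
def leftTransHom : SL2Ring k →ₐ[k] SL2Ring k ⊗[k] SL2Ring k :=
  eval ((univR k (SL2Ring k))⁻¹ * univL k (SL2Ring k))

theorem comulAlgHom_eq : Bialgebra.comulAlgHom k (SL2Ring k) = comulHom k := rfl

theorem counitAlgHom_eq : Bialgebra.counitAlgHom k (SL2Ring k) = counitHom k := rfl

/-- `k[SL₂]` as an `SL₂`-module: `SL₂` acts by left translation, `(g • f)(x) = f(g⁻¹ x)`. -/
def leftTrans : Coaction k (SL2Ring k) (SL2Ring k) where
  ρ := (leftTransHom k).toLinearMap
  coassoc := by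
    have h : ((Algebra.TensorProduct.assoc k k k (SL2Ring k) (SL2Ring k) (SL2Ring k)).toAlgHom.comp
        (Algebra.TensorProduct.map (leftTransHom k) (AlgHom.id k (SL2Ring k)))).comp
          (leftTransHom k) =
        (Algebra.TensorProduct.map (AlgHom.id k (SL2Ring k)) (comulHom k)).comp
          (leftTransHom k) := by
      set Φ₁ := (Algebra.TensorProduct.assoc k k k (SL2Ring k) (SL2Ring k) (SL2Ring k)).toAlgHom.comp
        (Algebra.TensorProduct.map (leftTransHom k) (AlgHom.id k (SL2Ring k)))
      set Φ₂ := Algebra.TensorProduct.map (AlgHom.id k (SL2Ring k)) (comulHom k)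
      let ψ : SL2Ring k ⊗[k] SL2Ring k →ₐ[k] SL2Ring k ⊗[k] (SL2Ring k ⊗[k] SL2Ring k) :=
        (Algebra.TensorProduct.assoc k k k (SL2Ring k) (SL2Ring k) (SL2Ring k)).toAlgHom.comp
          Algebra.TensorProduct.includeLeft
      let χ : SL2Ring k ⊗[k] SL2Ring k →ₐ[k] SL2Ring k ⊗[k] (SL2Ring k ⊗[k] SL2Ring k) :=
        Algebra.TensorProduct.includeRight
      have a1 : mapSL Φ₁ (univL k (SL2Ring k)) = mapSL ψ (mapSL (leftTransHom k) (univ k)) := by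
        ext i j
        change Φ₁ (coord k i j ⊗ₜ 1) = ψ (leftTransHom k (coord k i j))
        simp [Φ₁, ψ]
      have a2 : mapSL Φ₁ (univR k (SL2Ring k)) = mapSL χ (univR k (SL2Ring k)) := by
        ext i j
        change Φ₁ (1 ⊗ₜ coord k i j) = χ (1 ⊗ₜ coord k i j)
        simp [Φ₁, χ, Algebra.TensorProduct.one_def]
      have a3 : mapSL ψ (univL k (SL2Ring k)) = mapSL Φ₂ (univL k (SL2Ring k)) := by
        ext i j
        change ψ (coord k i j ⊗ₜ 1) = Φ₂ (coord k i j ⊗ₜ 1)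
        simp [Φ₂, ψ, Algebra.TensorProduct.one_def]
      have a4 : mapSL ψ (univR k (SL2Ring k)) = mapSL χ (univL k (SL2Ring k)) := by
        ext i j
        change ψ (1 ⊗ₜ coord k i j) = χ (coord k i j ⊗ₜ 1)
        simp [χ, ψ]
      have a5 : mapSL Φ₂ (univR k (SL2Ring k)) = mapSL χ (mapSL (comulHom k) (univ k)) := by
        ext i j
        change Φ₂ (1 ⊗ₜ coord k i j) = χ (comulHom k (coord k i j))
        simp [Φ₂, χ]
      rw [leftTransHom, comp_eval, comp_eval, map_mul, map_inv, map_mul, map_inv, a1, a2, a5,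
        leftTransHom, mapSL_eval, comulHom, mapSL_eval, map_mul, map_mul, map_inv, a3, a4,
        mul_inv_rev, mul_assoc]
    exact congrArg AlgHom.toLinearMap h
  counit_comp := by
    have h : ((Algebra.TensorProduct.rid k k (SL2Ring k)).toAlgHom.comp
        (Algebra.TensorProduct.map (AlgHom.id k (SL2Ring k)) (counitHom k))).comp
          (leftTransHom k) = AlgHom.id k (SL2Ring k) := by
      set Φ := (Algebra.TensorProduct.rid k k (SL2Ring k)).toAlgHom.comp
        (Algebra.TensorProduct.map (AlgHom.id k (SL2Ring k)) (counitHom k))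
      have a1 : mapSL Φ (univL k (SL2Ring k)) = univ k := by
        ext i j
        change Φ (coord k i j ⊗ₜ 1) = coord k i j
        simp [Φ]
      have a2 : mapSL Φ (univR k (SL2Ring k)) = 1 := by
        ext i j
        change Φ (1 ⊗ₜ coord k i j) = _
        simp [Φ, counitHom_coord, Matrix.one_apply]
      rw [leftTransHom, comp_eval, map_mul, map_inv, a1, a2, inv_one, one_mul]
      apply hom_ext
      rw [mapSL_eval]
      ext i j
      rfl
    exact congrArg AlgHom.toLinearMap h

end SL2Ring

/-! ### Subgroups of `SL₂` and quotients -/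

/-- A subgroup functor of `SL₂`. -/
structure SubgroupFunctor where
  pts (A : Type u) [CommRing A] [Algebra k A] : Subgroup SL(2, A)
  map_mem {A B : Type u} [CommRing A] [Algebra k A] [CommRing B] [Algebra k B] (φ : A →ₐ[k] B)
    {g : SL(2, A)} (hg : g ∈ pts A) : SL2Ring.mapSL φ g ∈ pts B

/-- The diagonal torus `T`. -/
def torus : SubgroupFunctor k where
  pts A _ _ :=
    { carrier := {g | g 0 1 = 0 ∧ g 1 0 = 0}
      mul_mem' := by
        rintro g h ⟨h1, h2⟩ ⟨h3, h4⟩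
        simp [Matrix.mul_apply, Fin.sum_univ_two, h1, h2, h3, h4]
      one_mem' := by simp
      inv_mem' := by
        rintro g ⟨h1, h2⟩
        simp [Matrix.SpecialLinearGroup.coe_inv, Matrix.adjugate_fin_two, h1, h2] }
  map_mem := by
    rintro A B _ _ _ _ φ g ⟨h1, h2⟩
    constructor
    · change φ (g 0 1) = 0
      rw [h1, map_zero]
    · change φ (g 1 0) = 0
      rw [h2, map_zero]

variable {k}

/-- The normalizer of a subgroup functor `H`: the elements of `SL₂(A)` that normalize `H(B)` for
every `A`-algebra `B`. -/
def SubgroupFunctor.normalizer (H : SubgroupFunctor k) : SubgroupFunctor k where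
  pts A _ _ :=
    { carrier := {g | ∀ (B : Type u) [CommRing B] [Algebra k B] (φ : A →ₐ[k] B),
        SL2Ring.mapSL φ g ∈ Subgroup.normalizer (H.pts B : Set SL(2, B))}
      mul_mem' := by
        intro g h hg hh B _ _ φ
        rw [map_mul]
        exact mul_mem (hg B φ) (hh B φ)
      one_mem' := by
        intro B _ _ φ
        rw [map_one]
        exact one_mem _
      inv_mem' := by
        intro g hg B _ _ φ
        rw [map_inv]
        exact inv_mem (hg B φ) }
  map_mem := by
    intro A B _ _ _ _ φ g hg C _ _ ψ
    exact hg C (ψ.comp φ)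

/-- The ring `k[SL₂/H]` of functions `f` on `SL₂` with `f(gh) = f(g)` for all `h ∈ H`. -/
def SubgroupFunctor.coordQuot (H : SubgroupFunctor k) : Subalgebra k (SL2Ring k) where
  carrier := {f | ∀ (A : Type u) [CommRing A] [Algebra k A] (g h : SL(2, A)), h ∈ H.pts A →
    SL2Ring.eval (g * h) f = SL2Ring.eval g f}
  mul_mem' := by
    intro x y hx hy A _ _ g h hh
    rw [map_mul, map_mul, hx A g h hh, hy A g h hh]
  add_mem' := by
    intro x y hx hy A _ _ g h hh
    rw [map_add, map_add, hx A g h hh, hy A g h hh]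
  algebraMap_mem' := by
    intro c A _ _ g h hh
    rw [AlgHom.commutes, AlgHom.commutes]

theorem SubgroupFunctor.coordQuot_isStable (H : SubgroupFunctor k) :
    (SL2Ring.leftTrans k).IsStable (Subalgebra.toSubmodule H.coordQuot) := by
  classical
  intro f hf
  let b := Module.Basis.ofVectorSpace k (SL2Ring k)
  let e (X : Type u) [CommRing X] [Algebra k X] :=
    TensorProduct.equivFinsuppOfBasisRight (M := X) b
  have he : ∀ (X : Type u) [CommRing X] [Algebra k X] (φ : SL2Ring k →ₐ[k] X)
      (z : SL2Ring k ⊗[k] SL2Ring k) (i),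
      e X (φ.toLinearMap.rTensor (SL2Ring k) z) i = φ (e (SL2Ring k) z i) := by
    intro X _ _ φ z i
    induction z using TensorProduct.induction_on with
    | zero => simp
    | tmul x y => simp [e]
    | add x y hx hy => simp only [map_add, Finsupp.add_apply, hx, hy]
  have key : ∀ (A : Type u) [CommRing A] [Algebra k A] (g h : SL(2, A)), h ∈ H.pts A →
      (SL2Ring.eval (k := k) (g * h)).toLinearMap.rTensor (SL2Ring k) (SL2Ring.leftTransHom k f) =
      (SL2Ring.eval (k := k) g).toLinearMap.rTensor (SL2Ring k) (SL2Ring.leftTransHom k f) := by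
    intro A _ _ g h hh
    have hmap : ∀ g' : SL(2, A), ∀ z : SL2Ring k ⊗[k] SL2Ring k,
        (SL2Ring.eval (k := k) g').toLinearMap.rTensor (SL2Ring k) z =
        Algebra.TensorProduct.map (SL2Ring.eval g') (AlgHom.id k (SL2Ring k)) z :=
      fun _ _ => rfl
    have hcomp : ∀ g' : SL(2, A),
        Algebra.TensorProduct.map (SL2Ring.eval g') (AlgHom.id k (SL2Ring k))
          (SL2Ring.leftTransHom k f) = SL2Ring.eval ((SL2Ring.univR k A)⁻¹ *
            SL2Ring.mapSL (Algebra.TensorProduct.includeLeft : A →ₐ[k] A ⊗[k] SL2Ring k) g') f := by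
      intro g'
      rw [← AlgHom.comp_apply, SL2Ring.leftTransHom, SL2Ring.comp_eval, map_mul, map_inv]
      have a1 : SL2Ring.mapSL (Algebra.TensorProduct.map (SL2Ring.eval g')
          (AlgHom.id k (SL2Ring k))) (SL2Ring.univR k (SL2Ring k)) = SL2Ring.univR k A := by
        ext i j
        change Algebra.TensorProduct.map (SL2Ring.eval g') (AlgHom.id k (SL2Ring k))
          (1 ⊗ₜ SL2Ring.coord k i j) = 1 ⊗ₜ SL2Ring.coord k i j
        simp
      have a2 : SL2Ring.mapSL (Algebra.TensorProduct.map (SL2Ring.eval g')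
          (AlgHom.id k (SL2Ring k))) (SL2Ring.univL k (SL2Ring k)) =
          SL2Ring.mapSL (Algebra.TensorProduct.includeLeft : A →ₐ[k] A ⊗[k] SL2Ring k) g' := by
        ext i j
        change Algebra.TensorProduct.map (SL2Ring.eval g') (AlgHom.id k (SL2Ring k))
          (SL2Ring.coord k i j ⊗ₜ 1) = g' i j ⊗ₜ 1
        simp
      rw [a1, a2]
    rw [hmap, hmap, hcomp, hcomp, map_mul, ← mul_assoc]
    exact hf _ _ _ (H.map_mem _ hh)
  change SL2Ring.leftTransHom k f ∈ _
  rw [← (e (SL2Ring k)).symm_apply_apply (SL2Ring.leftTransHom k f)]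
  have hmem : ∀ i, e (SL2Ring k) (SL2Ring.leftTransHom k f) i ∈ H.coordQuot := by
    intro i A _ _ g h hh
    rw [← he, ← he, key A g h hh]
  rw [TensorProduct.equivFinsuppOfBasisRight_symm_apply]
  refine Submodule.sum_mem _ fun i _ => ⟨⟨_, hmem i⟩ ⊗ₜ b i, ?_⟩
  rw [LinearMap.rTensor_tmul]
  rfl

/-- `k[SL₂/H]` as an `SL₂`-module, by left translation. -/
def SubgroupFunctor.quotMod (H : SubgroupFunctor k) :
    Coaction k (SL2Ring k) (Subalgebra.toSubmodule H.coordQuot) :=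
  (SL2Ring.leftTrans k).sub _ H.coordQuot_isStable

variable (k)

/-- The normalizer `N` of the diagonal torus. -/
def torusNormalizer : SubgroupFunctor k := (torus k).normalizer

theorem coordQuot_le : Subalgebra.toSubmodule (torusNormalizer k).coordQuot ≤
    Subalgebra.toSubmodule (torus k).coordQuot := by
  intro f hf A _ _ g h hh
  refine hf A g h fun B _ _ φ => ?_
  exact Subgroup.le_normalizer ((torus k).map_mem φ hh)

/-- The inclusion `k[G/N] → k[G/T]`. -/
def inclNT : Subalgebra.toSubmodule (torusNormalizer k).coordQuot →ₗ[k]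
    Subalgebra.toSubmodule (torus k).coordQuot :=
  Submodule.inclusion (coordQuot_le k)

theorem inclNT_equivariant :
    (torusNormalizer k).quotMod.IsEquivariant (torus k).quotMod (inclNT k) :=
  Coaction.inclusion_equivariant _ _ _ _ _ _

theorem inclNT_injective : Function.Injective (inclNT k) :=
  Submodule.inclusion_injective _

/-- The `G`-module `k[G/T] / k[G/N]`. -/
abbrev quotTN : Coaction k (SL2Ring k)
    (Subalgebra.toSubmodule (torus k).coordQuot ⧸ LinearMap.range (inclNT k)) :=
  Extension.quotByImage _ _ (inclNT k) (inclNT_equivariant k)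

/-- The function `ad`, an element of `k[G/T]`. -/
def ad : Subalgebra.toSubmodule (torus k).coordQuot :=
  ⟨SL2Ring.coord k 0 0 * SL2Ring.coord k 1 1, by
    rintro A _ _ g h ⟨h1, h2⟩
    have hdet := h.det_coe
    rw [Matrix.det_fin_two, h1, zero_mul, sub_zero] at hdet
    simp only [map_mul, SL2Ring.eval_coord, Matrix.SpecialLinearGroup.coe_mul, Matrix.mul_apply,
      Fin.sum_univ_two, h1, h2, mul_zero, add_zero, zero_add]
    linear_combination (g 0 0 * g 1 1) * hdet⟩

/-- The class of `ad` in `k[G/T] / k[G/N]`. -/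
def adClass : Subalgebra.toSubmodule (torus k).coordQuot ⧸ LinearMap.range (inclNT k) :=
  Submodule.Quotient.mk (ad k)

/-- The extension of `k` by `k[G/N]` given by the class of `ad`, once this class is known to be
invariant: the pullback of `0 → k[G/N] → k[G/T] → k[G/T] / k[G/N] → 0` along `1 ↦ [ad]`. -/
def adExtension (h : adClass k ∈ (quotTN k).invariants) : Extension (torusNormalizer k).quotMod :=
  Extension.pullback _ _ (inclNT k) (inclNT_equivariant k) (inclNT_injective k) (adClass k) h

end SL2

end RatCoh

/-! Write $u=ab$, $v=cd$, $w=ad$. Multiplying $ad-bc=1$ by $w$ gives $w^2=w+uv$, in characteristic 2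
an Artin–Schreier equation for $k[G/T]$ over $k[G/N]$. The matrix `!![0, 1; 1, 0]`, which has
determinant 1 in characteristic 2, lies in $N$ and sends $w$ to $bc=w+1$.

This gives $k[G/N]$. A $T$-invariant function is its own weight-zero part, hence a polynomial in
$u,v,w$, and the quadratic equation reduces it to $p+qw$ with $p,q\in k[u,v]$. Invariance under the
swap then forces $q=0$ (`adjoin_eq_torusNormalizer_coordQuot`). Independence of $u$ and $v$ is seen
on a two-parameter family of matrices.

An extension of $k$ splits over a group scheme exactly when $1$ has an invariant lift, and this is
equivalent to the vanishing of its class (`HasClass.eq_zero_iff`). For $\mathcal X$ the lifts of $1$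
correspond to the functions in the coset $w+k[G/N]$, so each splitting question asks for an
invariant function in that coset.

Over $G$ there is none: only constants are invariant under left translation, and $w\notin k[G/N]$
because the swap moves it (`not_splits_adExtension`). Over $G_r$ there is one, namely $w^{2^r}$: it
is $G_r$-invariant as a $2^r$-th power, and $w^{2^r}-w=\sum_{i<r}(uv)^{2^i}$ lies in $k[G/N]$
(`splits_res_adExtension`). The exponent depends on $r$, so these local splittings do not come from
one over $G$. The class of $\mathcal X$ is therefore a nonzero element of the kernel of the map to
the inverse limit. -/

namespace RatCoh

/-! ### Extensions of $k$, invariant lifts and classes in $H^1$. -/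

section General

variable {k C D M N : Type u} [Field k] [CommRing C] [Bialgebra k C] [CommRing D] [Bialgebra k D]
  [AddCommGroup M] [Module k M] [AddCommGroup N] [Module k N]

namespace Coaction

theorem mem_invariants_iff (ρ : Coaction k C M) (m : M) : m ∈ ρ.invariants ↔ ρ.ρ m = m ⊗ₜ 1 :=
  Iff.rfl

theorem mem_invariants_iff_d0 (ρ : Coaction k C M) (m : M) : m ∈ ρ.invariants ↔ ρ.d0 m = 0 :=
  sub_eq_zero.symm

theorem isEquivariant_d0 {ρ : Coaction k C M} {σ : Coaction k C N} {f : M →ₗ[k] N}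
    (hf : ρ.IsEquivariant σ f) (m : M) : f.rTensor C (ρ.d0 m) = σ.d0 (f m) := by
  have h := LinearMap.congr_fun hf m
  simp only [LinearMap.comp_apply] at h
  simp [d0, h]

theorem isEquivariant_d1 {ρ : Coaction k C M} {σ : Coaction k C N} {f : M →ₗ[k] N}
    (hf : ρ.IsEquivariant σ f) (z : M ⊗[k] C) :
    f.rTensor (C ⊗[k] C) (ρ.d1 z) = σ.d1 (f.rTensor C z) := by
  induction z using TensorProduct.induction_on with
  | zero => simp
  | add x y hx hy => simp only [map_add, hx, hy]
  | tmul m c =>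
    have h := LinearMap.congr_fun hf m
    simp only [LinearMap.comp_apply] at h
    have h' : f.rTensor (C ⊗[k] C) (TensorProduct.assoc k M C C (ρ.ρ m ⊗ₜ c)) =
        TensorProduct.assoc k N C C (f.rTensor C (ρ.ρ m) ⊗ₜ c) := by
      induction ρ.ρ m using TensorProduct.induction_on with
      | zero => simp
      | tmul x y => simp
      | add x y hx hy => simp only [TensorProduct.add_tmul, map_add, hx, hy]
    simp [d1, h', h]

theorem IsEquivariant.comp {P : Type u} [AddCommGroup P] [Module k P] {ρ : Coaction k C M}
    {σ : Coaction k C N} {τ : Coaction k C P} {g : N →ₗ[k] P} {f : M →ₗ[k] N}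
    (hg : σ.IsEquivariant τ g) (hf : ρ.IsEquivariant σ f) : ρ.IsEquivariant τ (g ∘ₗ f) := by
  unfold IsEquivariant at *
  rw [LinearMap.rTensor_comp, LinearMap.comp_assoc, hf, ← LinearMap.comp_assoc, hg,
    LinearMap.comp_assoc]

theorem fst_isEquivariant (ρ : Coaction k C M) (σ : Coaction k C N) :
    (ρ.prod σ).IsEquivariant ρ (LinearMap.fst k M N) := by
  have e1 : (LinearMap.fst k M N).rTensor C ∘ₗ (LinearMap.inl k M N).rTensor C =
      LinearMap.id := by
    rw [← LinearMap.rTensor_comp, LinearMap.fst_comp_inl, LinearMap.rTensor_id]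
  have e2 : (LinearMap.fst k M N).rTensor C ∘ₗ (LinearMap.inr k M N).rTensor C = 0 := by
    rw [← LinearMap.rTensor_comp, LinearMap.fst_comp_inr, LinearMap.rTensor_zero]
  unfold IsEquivariant prod
  rw [LinearMap.comp_add, ← LinearMap.comp_assoc, e1,
    ← LinearMap.comp_assoc _ _ ((LinearMap.fst k M N).rTensor C), e2,
    LinearMap.zero_comp, add_zero, LinearMap.id_comp]

theorem H1.mk_eq_zero_iff (ρ : Coaction k C M) (z : LinearMap.ker ρ.d1) :
    H1.mk ρ z = 0 ↔ ∃ m, ρ.d0 m = z := by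
  refine (Submodule.Quotient.mk_eq_zero _).trans ?_
  rfl

end Coaction

namespace Extension

variable {ρ : Coaction k C M} (X : Extension ρ)

/-- A linear section is determined by the image of $1$, and it is equivariant exactly when that
image is fixed. -/
theorem splits_iff_exists_invariant : X.Splits ↔ ∃ e ∈ X.coaction.invariants, X.p e = 1 := by
  constructor
  · rintro ⟨s, hs, hp⟩
    refine ⟨s 1, ?_, LinearMap.congr_fun hp 1⟩
    have h := LinearMap.congr_fun hs 1
    rw [Coaction.mem_invariants_iff]
    simpa [Coaction.trivial] using h.symm
  · rintro ⟨e, he, hp⟩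
    rw [Coaction.mem_invariants_iff] at he
    refine ⟨LinearMap.toSpanSingleton k X.E e, ?_, ?_⟩
    · apply LinearMap.ext_ring
      simp [Coaction.trivial, he]
    · apply LinearMap.ext_ring
      simp [hp]

/-- The action on $k$ is trivial, so `p` kills `d0 e`; exactness survives tensoring with `C` over a
field, which yields `z`. The cocycle condition may be checked after embedding in $E$, where it reads
$d_1d_0=0$. -/
theorem exists_d0_eq (e : X.E) :
    ∃ z : LinearMap.ker ρ.d1, X.i.rTensor C (z : M ⊗[k] C) = X.coaction.d0 e := by
  have hex : Function.Exact (X.i.rTensor C) (X.p.rTensor C) := Module.Flat.rTensor_exact C X.exact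
  obtain ⟨z, hz⟩ := (hex (X.coaction.d0 e)).1 (by
    rw [Coaction.isEquivariant_d0 X.p_equivariant]
    simp [Coaction.d0, Coaction.trivial])
  refine ⟨⟨z, ?_⟩, hz⟩
  apply Coaction.rTensor_injective X.i X.i_injective (C ⊗[k] C)
  rw [Coaction.isEquivariant_d1 X.i_equivariant, hz, map_zero]
  exact LinearMap.congr_fun X.coaction.d1_comp_d0 e

theorem exists_hasClass : ∃ ξ, X.HasClass ξ := by
  obtain ⟨e, he⟩ := X.p_surjective 1
  obtain ⟨z, hz⟩ := X.exists_d0_eq e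
  exact ⟨_, e, z, he, hz, rfl⟩

variable {X} in
-- Changing the lift `e` by `X.i m` changes its cocycle by `d0 m`. Hence the cocycle is a coboundary
-- exactly when some lift of $1$ is invariant.
theorem HasClass.eq_zero_iff {ξ : ρ.H1} (h : X.HasClass ξ) : ξ = 0 ↔ X.Splits := by
  obtain ⟨e, z, he, hz, rfl⟩ := h
  have hinj := Coaction.rTensor_injective X.i X.i_injective C
  rw [Coaction.H1.mk_eq_zero_iff, splits_iff_exists_invariant]
  simp only [Coaction.mem_invariants_iff_d0]
  constructor
  · rintro ⟨m, hm⟩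
    refine ⟨e - X.i m, ?_, ?_⟩
    · rw [map_sub, ← hz, ← Coaction.isEquivariant_d0 X.i_equivariant, hm, sub_self]
    · rw [map_sub, he, X.exact.apply_apply_eq_zero, sub_zero]
  · rintro ⟨e', h0, he'⟩
    obtain ⟨m, hm⟩ := (X.exact (e - e')).1 (by rw [map_sub, he, he', sub_self])
    refine ⟨m, hinj ?_⟩
    rw [hz, Coaction.isEquivariant_d0 X.i_equivariant, hm, map_sub, h0, sub_zero]

variable {X} in
-- The same lift `e` serves after restriction: `f` acts on the function factor and `X.i` on the
-- module factor, so the two commute.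
theorem HasClass.res {ξ : ρ.H1} (h : X.HasClass ξ) (f : C →ₐc[k] D) :
    (X.res f).HasClass (Coaction.H1.res ρ (ρ.res f) f rfl ξ) := by
  obtain ⟨e, z, he, hz, rfl⟩ := h
  have hz' : (f : C →ₗ[k] D).lTensor M (z : M ⊗[k] C) ∈ LinearMap.ker (ρ.res f).d1 := by
    have := LinearMap.congr_fun (Coaction.d1_compat ρ (ρ.res f) f rfl) z
    simp only [LinearMap.comp_apply] at this
    rw [LinearMap.mem_ker, this, LinearMap.mem_ker.1 z.2, map_zero]
  refine ⟨e, ⟨_, hz'⟩, he, ?_, (Coaction.H1.res_mk ρ (ρ.res f) f rfl z ⟨_, hz'⟩ rfl).symm⟩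
  have h1 := LinearMap.congr_fun (Coaction.d0_compat X.coaction (X.coaction.res f) f rfl) e
  have h2 : X.i.rTensor D ((f : C →ₗ[k] D).lTensor M (z : M ⊗[k] C)) =
      (f : C →ₗ[k] D).lTensor X.E (X.i.rTensor C (z : M ⊗[k] C)) := by
    rw [← LinearMap.comp_apply, ← LinearMap.comp_apply, LinearMap.rTensor_comp_lTensor,
      LinearMap.lTensor_comp_rTensor]
  exact h2.trans ((congrArg _ hz).trans h1.symm)

/-- Invariance of an element of an extension of `k` by `M` can be tested after an equivariant map
that is injective on `M`. -/
theorem mem_invariants_iff_of_injective {σ : Coaction k C N} {g : X.E →ₗ[k] N}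
    (hg : X.coaction.IsEquivariant σ g) (hi : Function.Injective (g ∘ₗ X.i)) (e : X.E) :
    e ∈ X.coaction.invariants ↔ g e ∈ σ.invariants := by
  rw [Coaction.mem_invariants_iff_d0, Coaction.mem_invariants_iff_d0,
    ← Coaction.isEquivariant_d0 hg]
  refine ⟨fun h => by rw [h, map_zero], fun h => ?_⟩
  -- Although `g` need not be injective on $E$, the element `d0 e` comes from $M\otimes C$, since
  -- $k$ is a trivial module. There `g ∘ₗ X.i` stays injective after tensoring.
  have hex : Function.Exact (X.i.rTensor C) (X.p.rTensor C) := Module.Flat.rTensor_exact C X.exact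
  obtain ⟨z, hz⟩ := (hex (X.coaction.d0 e)).1 (by
    rw [Coaction.isEquivariant_d0 X.p_equivariant]
    simp [Coaction.d0, Coaction.trivial])
  rw [← hz, ← LinearMap.comp_apply, ← LinearMap.rTensor_comp] at h
  rw [← hz, Coaction.rTensor_injective _ hi C (h.trans (map_zero _).symm), map_zero]

end Extension

/-- The `p ^ r`-th power of a function is invariant under the `r`-th Frobenius kernel: in
`A ⊗ k[H_r]`, the `p ^ r`-th power of `z` only depends on the value of `z` at the identity. -/
theorem map_toFrobeniusKernel_pow {A : Type u} [CommRing A] [Algebra k A] (p : ℕ) [Fact p.Prime]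
    [CharP k p] (r : ℕ) (z : A ⊗[k] C) :
    (toFrobeniusKernel k C p r : C →ₗ[k] FrobeniusKernel k C p r).lTensor A (z ^ p ^ r) =
      (TensorProduct.rid k A ((Coalgebra.counit (R := k) (A := C)).lTensor A z) ^ p ^ r)
        ⊗ₜ[k] 1 := by
  set π := toFrobeniusKernel k C p r
  -- Split $f=(f-\varepsilon(f))+\varepsilon(f)$. The $p^r$-th power is additive, and that of the
  -- first summand is a generator of the Frobenius ideal.
  have hπ : ∀ f : C, π f ^ p ^ r =
      algebraMap k _ (Coalgebra.counit (R := k) f ^ p ^ r) := by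
    intro f
    have hc : Coalgebra.counit (R := k)
        (f - algebraMap k C (Coalgebra.counit (R := k) f)) = 0 := by
      simp
    have h0 : π ((f - algebraMap k C (Coalgebra.counit (R := k) f)) ^ p ^ r) = 0 :=
      Ideal.Quotient.eq_zero_iff_mem.2 (Ideal.subset_span ⟨_, hc, rfl⟩)
    have h1 := add_pow_of_algebra k p r (f - algebraMap k C (Coalgebra.counit (R := k) f))
      (algebraMap k C (Coalgebra.counit (R := k) f))
    rw [sub_add_cancel] at h1
    rw [← map_pow, h1, map_add, h0, zero_add, ← map_pow, AlgHomClass.commutes]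
  have hmap : ∀ z : A ⊗[k] C, (π : C →ₗ[k] FrobeniusKernel k C p r).lTensor A z =
      Algebra.TensorProduct.map (AlgHom.id k A) (π : C →ₐ[k] FrobeniusKernel k C p r) z :=
    fun _ => rfl
  rw [hmap, map_pow]
  induction z using TensorProduct.induction_on with
  | zero => simp [(Fact.out : p.Prime).ne_zero]
  | tmul x y =>
    rw [Algebra.TensorProduct.map_tmul, Algebra.TensorProduct.tmul_pow, LinearMap.lTensor_tmul,
      TensorProduct.rid_tmul, smul_pow, TensorProduct.smul_tmul]
    congr 1
    exact (hπ y).trans (Algebra.algebraMap_eq_smul_one _)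
  | add x y hx hy =>
    rw [map_add, add_pow_of_algebra k, hx, hy, map_add, map_add, add_pow_of_algebra k,
      TensorProduct.add_tmul]

end General

end RatCoh

namespace RatCoh

/-! ### The normalizer of the torus and the functions invariant under it. -/

section SL2

variable (k : Type u) [Field k]

theorem mem_torus_pts_iff {A : Type u} [CommRing A] [Algebra k A] (g : SL(2, A)) :
    g ∈ (torus k).pts A ↔ g 0 1 = 0 ∧ g 1 0 = 0 := Iff.rfl

theorem SL2_mul_apply {A : Type u} [CommRing A] (g h : SL(2, A)) (i j : Fin 2) :
    (g * h) i j = g i 0 * h 0 j + g i 1 * h 1 j := by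
  rw [Matrix.SpecialLinearGroup.coe_mul, Matrix.mul_apply, Fin.sum_univ_two]

/-- The point `diag(t, t⁻¹)` of `SL₂` over the Laurent polynomials. -/
noncomputable def laurentDiag (A : Type u) [CommRing A] : SL(2, LaurentPolynomial A) :=
  ⟨!![LaurentPolynomial.T 1, 0; 0, LaurentPolynomial.T (-1)], by
    rw [Matrix.det_fin_two_of, ← LaurentPolynomial.T_add]
    simp⟩

section

variable (A : Type u) [CommRing A]

theorem laurentDiag_zero_zero : laurentDiag A 0 0 = LaurentPolynomial.T 1 := rfl

theorem laurentDiag_zero_one : laurentDiag A 0 1 = 0 := rfl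

theorem laurentDiag_one_zero : laurentDiag A 1 0 = 0 := rfl

theorem laurentDiag_one_one : laurentDiag A 1 1 = LaurentPolynomial.T (-1) := rfl

end

theorem laurentDiag_mem (A : Type u) [CommRing A] [Algebra k A] :
    laurentDiag A ∈ (torus k).pts (LaurentPolynomial A) :=
  ⟨rfl, rfl⟩

/-- The inclusion of the constants into the Laurent polynomials. -/
noncomputable abbrev laurentC (A : Type u) [CommRing A] [Algebra k A] :
    A →ₐ[k] LaurentPolynomial A :=
  IsScalarTower.toAlgHom k A (LaurentPolynomial A)

variable {k} in
-- Conjugating the generic torus point $\mathrm{diag}(t,t^{-1})$ by $h$ gives off-diagonal entries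
-- $\mp(t-t^{-1})$ times the products of the row entries of $h$, and these must vanish. Over a ring
-- with zero divisors only the products can be concluded to be zero, and they suffice.
theorem entries_of_mem_torusNormalizer {A : Type u} [CommRing A] [Algebra k A] {h : SL(2, A)}
    (hh : h ∈ (torusNormalizer k).pts A) : h 0 0 * h 0 1 = 0 ∧ h 1 0 * h 1 1 = 0 := by
  have h1 := (Subgroup.mem_normalizer_iff.1 (hh _ (laurentC k A)) (laurentDiag A)).1
    (laurentDiag_mem k A)
  have hC : ∀ i j, SL2Ring.mapSL (laurentC k A) h i j = LaurentPolynomial.C (h i j) :=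
    fun _ _ => rfl
  obtain ⟨e1, e2⟩ := h1
  simp only [SL2_mul_apply, Matrix.SpecialLinearGroup.coe_inv, Matrix.adjugate_fin_two, hC,
    laurentDiag_zero_zero, laurentDiag_zero_one, laurentDiag_one_zero, laurentDiag_one_one,
    Matrix.of_apply, Matrix.cons_val', Matrix.cons_val_zero, Matrix.cons_val_one,
    Matrix.cons_val_fin_one, mul_zero, add_zero, zero_add] at e1 e2
  have e1' : LaurentPolynomial.C (h 0 0 * h 0 1) * LaurentPolynomial.T 1 =
      LaurentPolynomial.C (h 0 0 * h 0 1) * LaurentPolynomial.T (-1) := by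
    rw [map_mul]; linear_combination -e1
  have e2' : LaurentPolynomial.C (h 1 0 * h 1 1) * LaurentPolynomial.T 1 =
      LaurentPolynomial.C (h 1 0 * h 1 1) * LaurentPolynomial.T (-1) := by
    rw [map_mul]; linear_combination e2
  -- Compare the coefficients of $t$: the right-hand side only has one at $t^{-1}$.
  have key : ∀ x : A, LaurentPolynomial.C x * LaurentPolynomial.T 1 =
      LaurentPolynomial.C x * LaurentPolynomial.T (-1) → x = 0 := by
    intro x hx
    rw [← LaurentPolynomial.single_eq_C_mul_T, ← LaurentPolynomial.single_eq_C_mul_T] at hx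
    have h := congrArg (fun q => q.coeff (1 : ℤ)) hx
    change (Finsupp.single (1 : ℤ) x) 1 = (Finsupp.single (-1 : ℤ) x) 1 at h
    simpa [Finsupp.single_apply] using h
  exact ⟨key _ e1', key _ e2'⟩

variable [CharP k 2]

theorem two_eq_zero_of_algebra (A : Type u) [CommRing A] [Algebra k A] : (2 : A) = 0 := by
  rw [← map_ofNat (algebraMap k A) 2, CharTwo.two_eq_zero, map_zero]

/-- The matrix `!![0, 1; 1, 0]`, an element of `N(A)` when `2 = 0` in `A`. -/
def swapPt (A : Type u) [CommRing A] [Algebra k A] : SL(2, A) :=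
  ⟨!![0, 1; 1, 0], by
    rw [Matrix.det_fin_two_of]
    linear_combination -two_eq_zero_of_algebra k A⟩

section

variable (A : Type u) [CommRing A] [Algebra k A]

theorem swapPt_zero_zero : swapPt k A 0 0 = 0 := rfl

theorem swapPt_zero_one : swapPt k A 0 1 = 1 := rfl

theorem swapPt_one_zero : swapPt k A 1 0 = 1 := rfl

theorem swapPt_one_one : swapPt k A 1 1 = 0 := rfl

end

/-- Conjugation by the swap exchanges the two off-diagonal entries, so it preserves the two
equations of $T$ up to order. -/
theorem swapPt_mem (A : Type u) [CommRing A] [Algebra k A] :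
    swapPt k A ∈ (torusNormalizer k).pts A := by
  intro B _ _ φ
  have hs : SL2Ring.mapSL φ (swapPt k A) = swapPt k B := by
    ext i j
    change φ (swapPt k A i j) = _
    fin_cases i <;> fin_cases j <;> simp [swapPt]
  rw [hs, Subgroup.mem_normalizer_iff]
  intro x
  simp [mem_torus_pts_iff, SL2_mul_apply, Matrix.SpecialLinearGroup.coe_inv,
    Matrix.adjugate_fin_two, swapPt_zero_zero, swapPt_zero_one, swapPt_one_zero, swapPt_one_one,
    and_comm]

/-- The function `ab` lies in `k[G/N]`, as does `cd`. -/
theorem coord_mul_coord_mem (i : Fin 2) :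
    SL2Ring.coord k i 0 * SL2Ring.coord k i 1 ∈ (torusNormalizer k).coordQuot := by
  intro A _ _ g h hh
  obtain ⟨h1, h2⟩ := entries_of_mem_torusNormalizer hh
  have hdet := h.det_coe
  rw [Matrix.det_fin_two] at hdet
  simp only [map_mul, SL2Ring.eval_coord, Matrix.SpecialLinearGroup.coe_mul, Matrix.mul_apply,
    Fin.sum_univ_two]
  -- For a row $(x,y)$ of $g$, the product of the new entries is
  -- $x^2h_{00}h_{01}+y^2h_{10}h_{11}+xy(h_{00}h_{11}+h_{01}h_{10})$. The last bracket is $\det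
  -- h+2h_{01}h_{10}=1$ in characteristic 2.
  linear_combination (g i 0) ^ 2 * h1 + (g i 1) ^ 2 * h2 + (g i 0 * g i 1) * hdet +
    (g i 0 * g i 1 * h 0 1 * h 1 0) * two_eq_zero_of_algebra k A

omit [CharP k 2] in
-- This is the determinant equation multiplied by $ad$, with $ad\cdot bc$ regrouped as $ab\cdot cd$.
-- It makes $k[G/T]$ quadratic over $k[ab,cd]$.
theorem ad_mul_self : (SL2Ring.coord k 0 0 * SL2Ring.coord k 1 1) ^ 2 =
    SL2Ring.coord k 0 0 * SL2Ring.coord k 1 1 +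
      (SL2Ring.coord k 0 0 * SL2Ring.coord k 0 1) * (SL2Ring.coord k 1 0 * SL2Ring.coord k 1 1) := by
  linear_combination (SL2Ring.coord k 0 0 * SL2Ring.coord k 1 1) * SL2Ring.coord_det k

/-- Iterating $w^2-w=uv$ with the additivity of squaring gives the telescoping sum
$\sum_{i<r}(uv)^{2^i}$. This puts the $G_r$-invariant function $w^{2^r}$ in the coset of $w$. -/
theorem ad_pow_sub_ad_mem (r : ℕ) :
    (SL2Ring.coord k 0 0 * SL2Ring.coord k 1 1) ^ 2 ^ r -
      SL2Ring.coord k 0 0 * SL2Ring.coord k 1 1 ∈ (torusNormalizer k).coordQuot := by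
  induction r with
  | zero => simp
  | succ r ih =>
    set w := SL2Ring.coord k 0 0 * SL2Ring.coord k 1 1 with hw
    have h1 : w ^ 2 - w ∈ (torusNormalizer k).coordQuot := by
      rw [hw, ad_mul_self, add_sub_cancel_left]
      exact mul_mem (coord_mul_coord_mem k 0) (coord_mul_coord_mem k 1)
    have h2 : w ^ 2 ^ (r + 1) - w = (w ^ 2 ^ r - w) ^ 2 + (w ^ 2 - w) := by
      rw [pow_succ, pow_mul]
      linear_combination (w ^ 2 ^ r * w - w ^ 2) * two_eq_zero_of_algebra k (SL2Ring k)
    rw [h2]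
    exact add_mem (pow_mem ih 2) h1

instance : Nontrivial (SL2Ring k) :=
  (SL2Ring.counitHom k).toRingHom.domain_nontrivial

theorem eval_swap_coord_zero (i : Fin 2) :
    SL2Ring.eval (SL2Ring.univ k * swapPt k (SL2Ring k)) (SL2Ring.coord k i 0) =
      SL2Ring.coord k i 1 := by
  rw [SL2Ring.eval_coord, SL2_mul_apply, swapPt_zero_zero, swapPt_one_zero]
  simp [SL2Ring.univ]

theorem eval_swap_coord_one (i : Fin 2) :
    SL2Ring.eval (SL2Ring.univ k * swapPt k (SL2Ring k)) (SL2Ring.coord k i 1) =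
      SL2Ring.coord k i 0 := by
  rw [SL2Ring.eval_coord, SL2_mul_apply, swapPt_zero_one, swapPt_one_one]
  simp [SL2Ring.univ]

omit [CharP k 2] in
theorem eval_univ (f : SL2Ring k) : SL2Ring.eval (SL2Ring.univ k) f = f :=
  AlgHom.congr_fun (SL2Ring.hom_ext (φ := SL2Ring.eval (SL2Ring.univ k))
    (ψ := AlgHom.id k _) (by rw [SL2Ring.mapSL_eval]; rfl)) f

/-- Besides $T$-invariance, this single instance is all that is used of $N$-invariance to bound
$k[G/N]$ from above. -/
theorem eval_swap_of_mem {f : SL2Ring k} (hf : f ∈ (torusNormalizer k).coordQuot) :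
    SL2Ring.eval (SL2Ring.univ k * swapPt k (SL2Ring k)) f = f :=
  (hf _ _ _ (swapPt_mem k _)).trans (eval_univ k f)

/-- Exchanging the columns turns $ad$ into $bc=ad-1$, the other root of the quadratic equation for
$ad$. -/
theorem eval_swap_ad :
    SL2Ring.eval (SL2Ring.univ k * swapPt k (SL2Ring k))
      (SL2Ring.coord k 0 0 * SL2Ring.coord k 1 1) =
      SL2Ring.coord k 0 0 * SL2Ring.coord k 1 1 + 1 := by
  rw [map_mul, eval_swap_coord_zero, eval_swap_coord_one]
  linear_combination -SL2Ring.coord_det k + (-1) * two_eq_zero_of_algebra k (SL2Ring k)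

theorem ad_notMem :
    SL2Ring.coord k 0 0 * SL2Ring.coord k 1 1 ∉ (torusNormalizer k).coordQuot := by
  intro h
  have h1 := eval_swap_of_mem k h
  rw [eval_swap_ad] at h1
  exact one_ne_zero (add_eq_left.1 h1)

/-! ### Weights of the torus and generators of $k[G/T]$ and $k[G/N]$. -/

omit [CharP k 2] in
-- Here $a,c$ have weight $1$ and $b,d$ weight $-1$, so in weight zero the factors can be paired
-- off. The induction strips factors $ab$; once $a$ or $b$ is exhausted, the other is paired with
-- $c$ or $d$, and what remains is a power of $cd$.
theorem monomial_mem_of_weight_zero {A : Type u} [CommRing A] [Algebra k A] (S : Subalgebra k A)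
    {a b c d : A} (hab : a * b ∈ S) (hcd : c * d ∈ S) (had : a * d ∈ S) (hbc : b * c ∈ S)
    (i j m n : ℕ) (h : i + m = j + n) : a ^ i * b ^ j * (c ^ m * d ^ n) ∈ S := by
  induction i generalizing j with
  | zero =>
    obtain rfl : m = j + n := by omega
    have : a ^ 0 * b ^ j * (c ^ (j + n) * d ^ n) = (b * c) ^ j * (c * d) ^ n := by ring
    rw [this]
    exact mul_mem (pow_mem hbc _) (pow_mem hcd _)
  | succ i ih =>
    cases j with
    | zero =>
      obtain rfl : n = i + 1 + m := by omega
      have : a ^ (i + 1) * b ^ 0 * (c ^ m * d ^ (i + 1 + m)) =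
          (a * d) ^ (i + 1) * (c * d) ^ m := by ring
      rw [this]
      exact mul_mem (pow_mem had _) (pow_mem hcd _)
    | succ j =>
      have : a ^ (i + 1) * b ^ (j + 1) * (c ^ m * d ^ n) =
          (a * b) * (a ^ i * b ^ j * (c ^ m * d ^ n)) := by ring
      rw [this]
      exact mul_mem hab (ih j (by omega))

/-- The action of `diag(t, t⁻¹)` on `k[SL₂]` by right translation. -/
noncomputable def weightHom : SL2Ring k →ₐ[k] LaurentPolynomial (SL2Ring k) :=
  SL2Ring.eval (SL2Ring.mapSL (laurentC k _) (SL2Ring.univ k) * laurentDiag (SL2Ring k))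

omit [CharP k 2] in
theorem weightHom_coord_zero (i : Fin 2) : weightHom k (SL2Ring.coord k i 0) =
    LaurentPolynomial.C (SL2Ring.coord k i 0) * LaurentPolynomial.T 1 := by
  rw [weightHom, SL2Ring.eval_coord, SL2_mul_apply, laurentDiag_zero_zero, laurentDiag_one_zero,
    mul_zero, add_zero]
  rfl

omit [CharP k 2] in
theorem weightHom_coord_one (i : Fin 2) : weightHom k (SL2Ring.coord k i 1) =
    LaurentPolynomial.C (SL2Ring.coord k i 1) * LaurentPolynomial.T (-1) := by
  rw [weightHom, SL2Ring.eval_coord, SL2_mul_apply, laurentDiag_zero_one, laurentDiag_one_one,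
    mul_zero, zero_add]
  rfl

omit [CharP k 2] in
theorem weightHom_monomial (i j m n : ℕ) :
    weightHom k (SL2Ring.coord k 0 0 ^ i * SL2Ring.coord k 0 1 ^ j *
      (SL2Ring.coord k 1 0 ^ m * SL2Ring.coord k 1 1 ^ n)) =
    LaurentPolynomial.C (SL2Ring.coord k 0 0 ^ i * SL2Ring.coord k 0 1 ^ j *
      (SL2Ring.coord k 1 0 ^ m * SL2Ring.coord k 1 1 ^ n)) *
      LaurentPolynomial.T ((i + m : ℤ) - (j + n)) := by
  have hT : (LaurentPolynomial.T ((i + m : ℤ) - (j + n)) : LaurentPolynomial (SL2Ring k)) =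
      LaurentPolynomial.T 1 ^ i * LaurentPolynomial.T (-1) ^ j *
        (LaurentPolynomial.T 1 ^ m * LaurentPolynomial.T (-1) ^ n) := by
    simp only [LaurentPolynomial.T_pow, ← LaurentPolynomial.T_add]
    congr 1
    ring
  simp only [hT, map_mul, map_pow, weightHom_coord_zero, weightHom_coord_one]
  ring

omit [CharP k 2] in
/-- The component of weight zero of a function is a polynomial in `ab`, `cd` and `ad`. -/
theorem weightHom_coeff_zero_mem (f : SL2Ring k) : (weightHom k f).coeff 0 ∈
    Algebra.adjoin k {SL2Ring.coord k 0 0 * SL2Ring.coord k 0 1,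
      SL2Ring.coord k 1 0 * SL2Ring.coord k 1 1, SL2Ring.coord k 0 0 * SL2Ring.coord k 1 1} := by
  set S := Algebra.adjoin k {SL2Ring.coord k 0 0 * SL2Ring.coord k 0 1,
      SL2Ring.coord k 1 0 * SL2Ring.coord k 1 1, SL2Ring.coord k 0 0 * SL2Ring.coord k 1 1}
  have hab : SL2Ring.coord k 0 0 * SL2Ring.coord k 0 1 ∈ S := Algebra.subset_adjoin (by simp)
  have hcd : SL2Ring.coord k 1 0 * SL2Ring.coord k 1 1 ∈ S := Algebra.subset_adjoin (by simp)
  have had : SL2Ring.coord k 0 0 * SL2Ring.coord k 1 1 ∈ S := Algebra.subset_adjoin (by simp)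
  -- Since $bc=ad-1$, this product is not needed as a generator.
  have hbc : SL2Ring.coord k 0 1 * SL2Ring.coord k 1 0 ∈ S := by
    rw [← sub_eq_iff_eq_add'.2 (sub_eq_iff_eq_add.1 (SL2Ring.coord_det k))]
    exact sub_mem had (one_mem _)
  obtain ⟨P, rfl⟩ : ∃ P, SL2Ring.proj k P = f := Ideal.Quotient.mk_surjective f
  induction P using MvPolynomial.induction_on' with
  | add p q hp hq => simpa using add_mem hp hq
  | monomial s r =>
    have hs : SL2Ring.proj k (MvPolynomial.monomial s r) =
        r • (SL2Ring.coord k 0 0 ^ s (0, 0) * SL2Ring.coord k 0 1 ^ s (0, 1) *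
          (SL2Ring.coord k 1 0 ^ s (1, 0) * SL2Ring.coord k 1 1 ^ s (1, 1))) := by
      rw [MvPolynomial.monomial_eq, Finsupp.prod_fintype _ _ (by simp), Fintype.prod_prod_type,
        Fin.prod_univ_two, Fin.prod_univ_two, Fin.prod_univ_two, ← MvPolynomial.smul_eq_C_mul,
        map_smul]
      simp only [map_mul, map_pow]
      rfl
    rw [hs, map_smul, weightHom_monomial, ← LaurentPolynomial.single_eq_C_mul_T]
    change r • (Finsupp.single _ _ : ℤ →₀ SL2Ring k) 0 ∈ S
    refine S.smul_mem ?_ r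
    rw [Finsupp.single_apply]
    split_ifs with h
    · exact monomial_mem_of_weight_zero k S hab hcd had hbc _ _ _ _ (by omega)
    · exact zero_mem S

omit [CharP k 2] in
-- Invariance at the generic torus point says that `weightHom k f` is the constant `f`, so `f` is
-- its own coefficient of weight zero.
theorem torus_coordQuot_le : (torus k).coordQuot ≤
    Algebra.adjoin k {SL2Ring.coord k 0 0 * SL2Ring.coord k 0 1,
      SL2Ring.coord k 1 0 * SL2Ring.coord k 1 1, SL2Ring.coord k 0 0 * SL2Ring.coord k 1 1} := by
  intro f hf
  have h : weightHom k f = LaurentPolynomial.C f := by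
    refine (hf _ _ _ (laurentDiag_mem k _)).trans ?_
    rw [← SL2Ring.comp_eval, AlgHom.comp_apply, eval_univ]
    rfl
  have := weightHom_coeff_zero_mem k f
  rw [h] at this
  simpa using this

omit [CharP k 2] in
-- By $w^2=w+uv$, the sums $p+qw$ with $p,q\in k[u,v]$ are closed under multiplication. Uniqueness
-- of $p$ and $q$ is not needed.
theorem exists_add_mul_ad {f : SL2Ring k} (hf : f ∈ (torus k).coordQuot) :
    ∃ p ∈ Algebra.adjoin k {SL2Ring.coord k 0 0 * SL2Ring.coord k 0 1,
        SL2Ring.coord k 1 0 * SL2Ring.coord k 1 1},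
      ∃ q ∈ Algebra.adjoin k {SL2Ring.coord k 0 0 * SL2Ring.coord k 0 1,
        SL2Ring.coord k 1 0 * SL2Ring.coord k 1 1},
      f = p + q * (SL2Ring.coord k 0 0 * SL2Ring.coord k 1 1) := by
  set S := Algebra.adjoin k {SL2Ring.coord k 0 0 * SL2Ring.coord k 0 1,
      SL2Ring.coord k 1 0 * SL2Ring.coord k 1 1}
  have hu : SL2Ring.coord k 0 0 * SL2Ring.coord k 0 1 ∈ S := Algebra.subset_adjoin (by simp)
  have hv : SL2Ring.coord k 1 0 * SL2Ring.coord k 1 1 ∈ S := Algebra.subset_adjoin (by simp)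
  have hw := ad_mul_self k
  replace hf := torus_coordQuot_le k hf
  induction hf using Algebra.adjoin_induction with
  | mem x hx =>
    rcases hx with rfl | rfl | rfl
    · exact ⟨_, hu, 0, zero_mem _, by ring⟩
    · exact ⟨_, hv, 0, zero_mem _, by ring⟩
    · exact ⟨0, zero_mem _, 1, one_mem _, by ring⟩
  | algebraMap r => exact ⟨_, S.algebraMap_mem r, 0, zero_mem _, by ring⟩
  | add x y _ _ hx hy =>
    obtain ⟨p, hp, q, hq, rfl⟩ := hx
    obtain ⟨p', hp', q', hq', rfl⟩ := hy
    exact ⟨_, add_mem hp hp', _, add_mem hq hq', by ring⟩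
  | mul x y _ _ hx hy =>
    obtain ⟨p, hp, q, hq, rfl⟩ := hx
    obtain ⟨p', hp', q', hq', rfl⟩ := hy
    refine ⟨_, add_mem (mul_mem hp hp') (mul_mem (mul_mem hq hq') (mul_mem hu hv)), _,
      add_mem (add_mem (mul_mem hp hq') (mul_mem hq hp')) (mul_mem hq hq'), ?_⟩
    linear_combination (q * q') * hw

theorem adjoin_eq_torusNormalizer_coordQuot :
    Algebra.adjoin k {SL2Ring.coord k 0 0 * SL2Ring.coord k 0 1,
      SL2Ring.coord k 1 0 * SL2Ring.coord k 1 1} = (torusNormalizer k).coordQuot := by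
  have hle : Algebra.adjoin k {SL2Ring.coord k 0 0 * SL2Ring.coord k 0 1,
      SL2Ring.coord k 1 0 * SL2Ring.coord k 1 1} ≤ (torusNormalizer k).coordQuot := by
    refine Algebra.adjoin_le ?_
    rintro _ (rfl | rfl)
    · exact coord_mul_coord_mem k 0
    · exact coord_mul_coord_mem k 1
  refine le_antisymm hle fun f hf => ?_
  obtain ⟨p, hp, q, hq, rfl⟩ := exists_add_mul_ad k (coordQuot_le k hf)
  -- The swap fixes $p$ and $q$ and sends $w$ to $w+1$, so it changes $p+qw$ by $q$; hence $q=0$.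
  have h := eval_swap_of_mem k hf
  rw [map_add, map_mul, eval_swap_of_mem k (hle hp), eval_swap_of_mem k (hle hq), eval_swap_ad,
    mul_add, ← add_assoc, mul_one, add_eq_left] at h
  simpa [h] using hp

/-! ### Algebraic independence of $ab$ and $cd$. -/

/-- The point `!![1 + xy, x; y, 1]` of `SL₂` over `k[y][x]`. -/
noncomputable def bigCell : SL(2, Polynomial (MvPolynomial (Fin 1) k)) :=
  ⟨!![1 + Polynomial.X * Polynomial.C (MvPolynomial.X 0), Polynomial.X;
    Polynomial.C (MvPolynomial.X 0), 1], by
    rw [Matrix.det_fin_two_of]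
    ring⟩

omit [CharP k 2] in
-- On the matrices `bigCell`, $cd$ becomes $y$ and $ab$ becomes $x+yx^2$. The latter is nonconstant
-- in $x$ over the domain $k[y]$, hence transcendental over it.
theorem algebraicIndependent_ab_cd :
    AlgebraicIndependent k ![SL2Ring.coord k 0 0 * SL2Ring.coord k 0 1,
      SL2Ring.coord k 1 0 * SL2Ring.coord k 1 1] := by
  -- The coefficients `C 1` and `C 0` are kept explicit to fit `Polynomial.natDegree_quadratic`.
  let q : Polynomial (MvPolynomial (Fin 1) k) :=
    Polynomial.C (MvPolynomial.X 0) * Polynomial.X ^ 2 + Polynomial.C 1 * Polynomial.X +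
      Polynomial.C 0
  have hq : q.natDegree = 2 := Polynomial.natDegree_quadratic (MvPolynomial.X_ne_zero 0)
  have e0 : SL2Ring.eval (bigCell k) (SL2Ring.coord k 0 0 * SL2Ring.coord k 0 1) = q := by
    rw [map_mul, SL2Ring.eval_coord, SL2Ring.eval_coord]
    change (1 + Polynomial.X * Polynomial.C (MvPolynomial.X 0)) * Polynomial.X = q
    simp only [q, map_one, map_zero]
    ring
  have e1 : SL2Ring.eval (bigCell k) (SL2Ring.coord k 1 0 * SL2Ring.coord k 1 1) =
      Polynomial.C (MvPolynomial.X 0) := by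
    rw [map_mul, SL2Ring.eval_coord, SL2Ring.eval_coord]
    exact mul_one _
  -- `finSuccEquiv` views a polynomial in two variables as one in the first over the ring of the
  -- second. Evaluation at the pair then becomes composition with `q`.
  have hcomp : (SL2Ring.eval (bigCell k)).comp
      (MvPolynomial.aeval ![SL2Ring.coord k 0 0 * SL2Ring.coord k 0 1,
        SL2Ring.coord k 1 0 * SL2Ring.coord k 1 1]) =
      ((Polynomial.aeval q).restrictScalars k).comp
        (MvPolynomial.finSuccEquiv k 1).toAlgHom := by
    apply MvPolynomial.algHom_ext
    refine Fin.forall_fin_two.2 ⟨?_, ?_⟩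
    · rw [AlgHom.comp_apply, MvPolynomial.aeval_X]
      refine e0.trans ?_
      change q = Polynomial.aeval q (MvPolynomial.finSuccEquiv k 1 (MvPolynomial.X 0))
      rw [MvPolynomial.finSuccEquiv_X_zero, Polynomial.aeval_X]
    · rw [AlgHom.comp_apply, MvPolynomial.aeval_X]
      refine e1.trans ?_
      change _ = Polynomial.aeval q (MvPolynomial.finSuccEquiv k 1 (MvPolynomial.X (Fin.succ 0)))
      rw [MvPolynomial.finSuccEquiv_X_succ, Polynomial.aeval_C]
      rfl
  rw [algebraicIndependent_iff_injective_aeval]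
  refine (injective_iff_map_eq_zero _).2 fun P hP => ?_
  have h1 := AlgHom.congr_fun hcomp P
  rw [AlgHom.comp_apply, hP, map_zero] at h1
  have h2 : (MvPolynomial.finSuccEquiv k 1 P).comp q = 0 := h1.symm
  rcases Polynomial.comp_eq_zero_iff.1 h2 with h | ⟨_, h⟩
  · simpa using h
  · rw [h, Polynomial.natDegree_C] at hq
    exact absurd hq (by norm_num)

end SL2

end RatCoh

namespace RatCoh

/-! ### Invariant functions and the splitting of the extension defined by $ad$. -/

section Invariants

variable (k : Type u) [Field k]

/-- The only functions on `SL₂` that are invariant under left translation are the constants. -/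
theorem exists_algebraMap_of_mem_invariants {f : SL2Ring k}
    (hf : f ∈ (SL2Ring.leftTrans k).invariants) : ∃ c, f = algebraMap k (SL2Ring k) c := by
  -- Multiplication restricts $(x,g)\mapsto f(g^{-1}x)$ to the diagonal $g=x$, where it is the
  -- constant $f(1)$; invariance says that it is also $f(x)$.
  let μ : SL2Ring k ⊗[k] SL2Ring k →ₐ[k] SL2Ring k := Algebra.TensorProduct.lmul' k
  have hL : SL2Ring.mapSL μ (SL2Ring.univL k (SL2Ring k)) = SL2Ring.univ k := by
    ext i j
    change μ (SL2Ring.coord k i j ⊗ₜ 1) = SL2Ring.coord k i j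
    simp [μ]
  have hR : SL2Ring.mapSL μ (SL2Ring.univR k (SL2Ring k)) = SL2Ring.univ k := by
    ext i j
    change μ (1 ⊗ₜ SL2Ring.coord k i j) = SL2Ring.coord k i j
    simp [μ]
  have h1 : μ (SL2Ring.leftTransHom k f) = f := by
    rw [show SL2Ring.leftTransHom k f = f ⊗ₜ 1 from hf]
    simp [μ]
  rw [← AlgHom.comp_apply, SL2Ring.leftTransHom, SL2Ring.comp_eval, map_mul, map_inv, hL, hR,
    inv_mul_cancel] at h1
  refine ⟨SL2Ring.counitHom k f, h1.symm.trans ?_⟩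
  have h2 : SL2Ring.mapSL (Algebra.ofId k (SL2Ring k)) (1 : SL(2, k)) = 1 := map_one _
  rw [← h2, ← SL2Ring.comp_eval]
  rfl

theorem SubgroupFunctor.subtype_isEquivariant (H : SubgroupFunctor k) :
    H.quotMod.IsEquivariant (SL2Ring.leftTrans k) (Subalgebra.toSubmodule H.coordQuot).subtype :=
  Coaction.sub_spec _ _ _

/-- The coaction is multiplicative, so it takes $f^{p^r}$ to the $p^r$-th power of the image of $f$.
On $G_r$ this depends only on the value at the identity, which is $f$ by the counit axiom. -/
theorem pow_mem_invariants_resFrob (p : ℕ) [Fact p.Prime] [CharP k p] (r : ℕ) (f : SL2Ring k) :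
    f ^ p ^ r ∈ ((SL2Ring.leftTrans k).resFrob p r).invariants := by
  have hmem : ∀ g : SL2Ring k, (toFrobeniusKernel k (SL2Ring k) p r : SL2Ring k →ₗ[k]
      FrobeniusKernel k (SL2Ring k) p r).lTensor (SL2Ring k) (SL2Ring.leftTransHom k g) =
      g ⊗ₜ[k] 1 → g ∈ ((SL2Ring.leftTrans k).resFrob p r).invariants := fun _ h => h
  apply hmem
  have h : TensorProduct.rid k (SL2Ring k)
      ((Coalgebra.counit (R := k) (A := SL2Ring k)).lTensor (SL2Ring k)
        (SL2Ring.leftTransHom k f)) = f :=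
    LinearMap.congr_fun (SL2Ring.leftTrans k).counit_comp f
  rw [map_pow, map_toFrobeniusKernel_pow, h]

/-- The equivariant map `E → k[G]`. -/
noncomputable def adExtensionVal (h : adClass k ∈ (quotTN k).invariants) :
    (adExtension k h).E →ₗ[k] SL2Ring k :=
  (Subalgebra.toSubmodule (torus k).coordQuot).subtype ∘ₗ LinearMap.fst k _ k ∘ₗ
    (LinearMap.ker (Extension.pullbackMap (inclNT k) (adClass k))).subtype

theorem adExtensionVal_isEquivariant (h : adClass k ∈ (quotTN k).invariants) :
    (adExtension k h).coaction.IsEquivariant (SL2Ring.leftTrans k) (adExtensionVal k h) :=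
  Coaction.IsEquivariant.comp (SubgroupFunctor.subtype_isEquivariant k (torus k))
    (Coaction.IsEquivariant.comp (Coaction.fst_isEquivariant _ _) (Coaction.sub_spec _ _
      (Coaction.isStable_ker _ _ _ (Extension.pullbackMap_equivariant _ _ _
        (inclNT_equivariant k) _ h))))

theorem adExtensionVal_comp_i_injective (h : adClass k ∈ (quotTN k).invariants) :
    Function.Injective (adExtensionVal k h ∘ₗ (adExtension k h).i) :=
  Subtype.val_injective.comp (inclNT_injective k)

/-- With `exists_adExtensionVal_eq`, this shows that the lifts of $1$ have the coset $ad+k[G/N]$ as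
their image, which turns splitting into a question about functions. -/
theorem adExtensionVal_sub_mem (h : adClass k ∈ (quotTN k).invariants) {e : (adExtension k h).E}
    (he : (adExtension k h).p e = 1) :
    adExtensionVal k h e - SL2Ring.coord k 0 0 * SL2Ring.coord k 1 1 ∈
      (torusNormalizer k).coordQuot := by
  obtain ⟨⟨n, t⟩, hn⟩ := e
  obtain rfl : t = 1 := he
  rw [LinearMap.mem_ker] at hn
  simp only [Extension.pullbackMap, LinearMap.sub_apply, LinearMap.comp_apply,
    LinearMap.fst_apply, LinearMap.snd_apply, LinearMap.toSpanSingleton_apply, one_smul] at hn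
  obtain ⟨m, hm⟩ := (Submodule.Quotient.eq _).1 (sub_eq_zero.1 hn)
  have hm' := congrArg Subtype.val hm
  have : (m : SL2Ring k) = n - SL2Ring.coord k 0 0 * SL2Ring.coord k 1 1 := hm'
  change (n : SL2Ring k) - _ ∈ _
  rw [← this]
  exact m.2

theorem exists_adExtensionVal_eq (h : adClass k ∈ (quotTN k).invariants) {f : SL2Ring k}
    (hf : f - SL2Ring.coord k 0 0 * SL2Ring.coord k 1 1 ∈ (torusNormalizer k).coordQuot) :
    ∃ e, (adExtension k h).p e = 1 ∧ adExtensionVal k h e = f := by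
  let m : Subalgebra.toSubmodule (torusNormalizer k).coordQuot := ⟨_, hf⟩
  refine ⟨⟨(inclNT k m + ad k, 1), ?_⟩, rfl, ?_⟩
  · rw [LinearMap.mem_ker]
    simp only [Extension.pullbackMap, LinearMap.sub_apply, LinearMap.comp_apply,
      LinearMap.fst_apply, LinearMap.snd_apply, LinearMap.toSpanSingleton_apply, one_smul]
    exact sub_eq_zero.2 ((Submodule.Quotient.eq _).2 ⟨m, (add_sub_cancel_right _ _).symm⟩)
  · exact sub_add_cancel f (SL2Ring.coord k 0 0 * SL2Ring.coord k 1 1)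

variable [CharP k 2]

/-- The product of the diagonal entries of $g^{-1}x$ contains $ad$ with coefficient
$1+2g_{01}g_{10}$. In characteristic 2 the second term drops, and apart from $ad\otimes1$ only left
factors $ab$, $cd$ and $1$ from $k[G/N]$ remain. -/
theorem leftTransHom_ad :
    SL2Ring.leftTransHom k (SL2Ring.coord k 0 0 * SL2Ring.coord k 1 1) =
      (SL2Ring.coord k 0 0 * SL2Ring.coord k 1 1) ⊗ₜ[k] 1 +
      ((SL2Ring.coord k 0 0 * SL2Ring.coord k 0 1) ⊗ₜ[k]
          (SL2Ring.coord k 1 1 * SL2Ring.coord k 1 0) +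
        (SL2Ring.coord k 1 0 * SL2Ring.coord k 1 1) ⊗ₜ[k]
          (SL2Ring.coord k 0 0 * SL2Ring.coord k 0 1) +
        1 ⊗ₜ[k] (SL2Ring.coord k 0 1 * SL2Ring.coord k 1 0)) := by
  set A := SL2Ring k ⊗[k] SL2Ring k
  let l : SL2Ring k →ₐ[k] A := Algebra.TensorProduct.includeLeft
  let r : SL2Ring k →ₐ[k] A := Algebra.TensorProduct.includeRight
  have htmul : ∀ x y : SL2Ring k, x ⊗ₜ[k] y = l x * r y := by
    intro x y
    change _ = (x ⊗ₜ[k] 1) * (1 ⊗ₜ[k] y)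
    rw [Algebra.TensorProduct.tmul_mul_tmul, mul_one, one_mul]
  have hL : ∀ i j, SL2Ring.univL k (SL2Ring k) i j = l (SL2Ring.coord k i j) := fun _ _ => rfl
  have hR : ∀ i j, SL2Ring.univR k (SL2Ring k) i j = r (SL2Ring.coord k i j) := fun _ _ => rfl
  have dL : l (SL2Ring.coord k 0 0) * l (SL2Ring.coord k 1 1) -
      l (SL2Ring.coord k 0 1) * l (SL2Ring.coord k 1 0) = 1 := by
    simpa only [map_sub, map_mul, map_one] using congrArg l (SL2Ring.coord_det k)
  have dR : r (SL2Ring.coord k 0 0) * r (SL2Ring.coord k 1 1) -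
      r (SL2Ring.coord k 0 1) * r (SL2Ring.coord k 1 0) = 1 := by
    simpa only [map_sub, map_mul, map_one] using congrArg r (SL2Ring.coord_det k)
  have h2 : (2 : A) = 0 := two_eq_zero_of_algebra k A
  rw [map_mul, SL2Ring.leftTransHom, SL2Ring.eval_coord, SL2Ring.eval_coord, SL2_mul_apply,
    SL2_mul_apply]
  simp only [Matrix.SpecialLinearGroup.coe_inv, Matrix.adjugate_fin_two, hL, hR, htmul, map_mul,
    map_one, Matrix.of_apply, Matrix.cons_val', Matrix.cons_val_zero, Matrix.cons_val_one,
    Matrix.cons_val_fin_one]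
  -- With the eight entries as free variables, the claim is a polynomial identity modulo the two
  -- determinant relations and $2=0$.
  generalize l (SL2Ring.coord k 0 0) = a at *
  generalize l (SL2Ring.coord k 0 1) = b at *
  generalize l (SL2Ring.coord k 1 0) = c at *
  generalize l (SL2Ring.coord k 1 1) = d at *
  generalize r (SL2Ring.coord k 0 0) = α at *
  generalize r (SL2Ring.coord k 0 1) = β at *
  generalize r (SL2Ring.coord k 1 0) = γ at *
  generalize r (SL2Ring.coord k 1 1) = δ at *
  linear_combination (a * d) * dR - (β * γ) * dL +
    (a * d * β * γ - a * b * γ * δ - c * d * α * β - β * γ) * h2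

theorem adClass_mem_invariants : adClass k ∈ (quotTN k).invariants := by
  have hinj := Coaction.rTensor_injective _
    (Subalgebra.toSubmodule (torus k).coordQuot).injective_subtype (SL2Ring k)
  let u : Subalgebra.toSubmodule (torusNormalizer k).coordQuot := ⟨_, coord_mul_coord_mem k 0⟩
  let v : Subalgebra.toSubmodule (torusNormalizer k).coordQuot := ⟨_, coord_mul_coord_mem k 1⟩
  let e : Subalgebra.toSubmodule (torusNormalizer k).coordQuot :=
    ⟨1, one_mem (torusNormalizer k).coordQuot⟩
  have h : (torus k).quotMod.ρ (ad k) = ad k ⊗ₜ 1 + (inclNT k).rTensor (SL2Ring k)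
      (u ⊗ₜ[k] (SL2Ring.coord k 1 1 * SL2Ring.coord k 1 0) +
        v ⊗ₜ[k] (SL2Ring.coord k 0 0 * SL2Ring.coord k 0 1) +
        e ⊗ₜ[k] (SL2Ring.coord k 0 1 * SL2Ring.coord k 1 0)) := by
    -- The identity is checked in $k[G]\otimes k[G]$, into which $k[G/T]\otimes k[G]$ embeds.
    apply hinj
    refine (LinearMap.congr_fun (SubgroupFunctor.subtype_isEquivariant k (torus k))
      (ad k)).trans ((leftTransHom_ad k).trans ?_)
    simp only [map_add, LinearMap.rTensor_tmul]
    rfl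
  rw [Coaction.mem_invariants_iff]
  have h1 := LinearMap.congr_fun (Coaction.quot_spec (torus k).quotMod _
    (Coaction.isStable_range _ _ (inclNT k) (inclNT_equivariant k))) (ad k)
  refine h1.symm.trans ?_
  rw [LinearMap.comp_apply, h, map_add, ← LinearMap.comp_apply (LinearMap.rTensor _ _),
    ← LinearMap.rTensor_comp, LinearMap.range_mkQ_comp, LinearMap.rTensor_zero]
  simp only [LinearMap.zero_apply, add_zero, LinearMap.rTensor_tmul]
  rfl

/-- An invariant lift of $1$ would be a constant in $ad+k[G/N]$. Constants lie in $k[G/N]$, so $ad$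
would too, against `ad_notMem`. -/
theorem not_splits_adExtension (h : adClass k ∈ (quotTN k).invariants) :
    ¬ (adExtension k h).Splits := by
  rw [Extension.splits_iff_exists_invariant]
  rintro ⟨e, he, hp⟩
  rw [Extension.mem_invariants_iff_of_injective _ (adExtensionVal_isEquivariant k h)
    (adExtensionVal_comp_i_injective k h)] at he
  obtain ⟨c, hc⟩ := exists_algebraMap_of_mem_invariants k he
  have := adExtensionVal_sub_mem k h hp
  rw [hc] at this
  refine ad_notMem k ?_
  rw [← sub_sub_cancel (algebraMap k (SL2Ring k) c) (SL2Ring.coord k 0 0 * SL2Ring.coord k 1 1)]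
  exact sub_mem (Subalgebra.algebraMap_mem _ c) this

/-- The invariant lift of $1$ is the one whose underlying function is $(ad)^{2^r}$. -/
theorem splits_res_adExtension (h : adClass k ∈ (quotTN k).invariants) (r : ℕ) :
    ((adExtension k h).res (toFrobeniusKernel k (SL2Ring k) 2 r)).Splits := by
  rw [Extension.splits_iff_exists_invariant]
  obtain ⟨e, hp, he⟩ := exists_adExtensionVal_eq k h (ad_pow_sub_ad_mem k r)
  refine ⟨e, ?_, hp⟩
  refine (Extension.mem_invariants_iff_of_injective
    ((adExtension k h).res (toFrobeniusKernel k (SL2Ring k) 2 r))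
    (σ := (SL2Ring.leftTrans k).resFrob 2 r) (g := adExtensionVal k h)
    (Extension.res_equivariant (adExtensionVal_isEquivariant k h) _)
    (adExtensionVal_comp_i_injective k h) e).2 ?_
  exact he ▸ pow_mem_invariants_resFrob k 2 r _

end Invariants

end RatCoh

/-! ### The main theorem. -/

theorem mainTheorem1 (k : Type u) [Field k] [CharP k 2] :
    -- `k[G/N]` is the polynomial ring in `ab` and `cd`
    (AlgebraicIndependent k ![RatCoh.SL2Ring.coord k 0 0 * RatCoh.SL2Ring.coord k 0 1,
        RatCoh.SL2Ring.coord k 1 0 * RatCoh.SL2Ring.coord k 1 1] ∧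
      Algebra.adjoin k {RatCoh.SL2Ring.coord k 0 0 * RatCoh.SL2Ring.coord k 0 1,
        RatCoh.SL2Ring.coord k 1 0 * RatCoh.SL2Ring.coord k 1 1} =
          (RatCoh.torusNormalizer k).coordQuot) ∧
    -- the class of `ad` in `k[G/T] / k[G/N]` is invariant
    (∃ h : RatCoh.adClass k ∈ (RatCoh.quotTN k).invariants,
      -- the extension it defines is nonsplit over `G`, but splits over every `G_r`
      ¬ (RatCoh.adExtension k h).Splits ∧
      (∀ r : ℕ+, ((RatCoh.adExtension k h).res
        (RatCoh.toFrobeniusKernel k (RatCoh.SL2Ring k) 2 r)).Splits) ∧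
      -- its class in `H¹(G, k[G/N])` is nonzero, and restricts to zero on every `G_r`
      (∃ ξ : (RatCoh.torusNormalizer k).quotMod.H1,
        (RatCoh.adExtension k h).HasClass ξ ∧ ξ ≠ 0 ∧
          ∀ r : ℕ+, RatCoh.H1.toFrob 2 (RatCoh.torusNormalizer k).quotMod r ξ = 0)) ∧
    -- `H¹(G, k[G/N])` is not the inverse limit of the `H¹(G_r, k[G/N])`
    ¬ Function.Bijective (RatCoh.H1.toFrobLimit 2 (RatCoh.torusNormalizer k).quotMod) := by
  have h := RatCoh.adClass_mem_invariants k
  obtain ⟨ξ, hξ⟩ := (RatCoh.adExtension k h).exists_hasClass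
  have hne : ξ ≠ 0 := fun h0 => RatCoh.not_splits_adExtension k h (hξ.eq_zero_iff.1 h0)
  have hres : ∀ r : ℕ+, RatCoh.H1.toFrob 2 (RatCoh.torusNormalizer k).quotMod r ξ = 0 := fun r =>
    (hξ.res _).eq_zero_iff.2 (RatCoh.splits_res_adExtension k h r)
  refine ⟨⟨RatCoh.algebraicIndependent_ab_cd k, RatCoh.adjoin_eq_torusNormalizer_coordQuot k⟩,
    ⟨h, RatCoh.not_splits_adExtension k h, fun r => RatCoh.splits_res_adExtension k h r, ξ, hξ,
      hne, hres⟩, fun hb => hne (hb.1 ?_)⟩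
  -- Injectivity is what fails: every component of the image of `ξ` vanishes, while `ξ` does not.
  rw [map_zero]
  exact Subtype.ext (funext hres)
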